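/- **Time-dependent matrix product ansatz for Rule 54.** Let $\chi(s_1,s_2,s_3)=s_1+s_2+s_3+s_1s_3 \pmod 2$. Consider a periodic chain of even length $n$ with sites labelled by the integers in $[-n/2+1,n/2]$ (read modulo $n$) and binary variables $s_x\in\{0,1\}$. Let $\mathbb U_{\mathrm e}$ (resp. $\mathbb U_{\mathrm o}$) be the $2^n\times 2^n$ permutation matrix of the simultaneous update $s_x\mapsto\chi(s_{x-1},s_x,s_{x+1})$ of all even (resp. odd) sites. Let $\rho$ be the projector onto $s_0=1$, and let $\rho(0)=\rho$, $\rho(t+1)=\mathbb U_{\mathrm e}\rho(t)\mathbb U_{\mathrm e}$ for even $t$, $\rho(t+1)=\mathbb U_{\mathrm o}\rho(t)\mathbb U_{\mathrm o}$ for odd $t$. For $\underline s=(s_{-t},\dots,s_t)\in\{0,1\}^{2t+1}$ let $|\underline s\rangle\langle\underline s|$ be the projector onto the configuration $\underline s$ on the sites $-t,\dots,t$. *Auxiliary space.* Let $\mathcal V$ be the (infinite-dimensional, real) span of the orthonormal vectors $|c,w,n,a\rangle$ with $c,w\in\mathbb N_0$, $n\in\{0,1,2\}$, $a\in\{0,1\}$.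 Put $\mathbf c^+|c,w,n,a\rangle=|c+1,w,n,a\rangle$, $\mathbf w^+|c,w,n,a\rangle=|c,w+1,n,a\rangle$, $\mathbf c^-=(\mathbf c^+)^T$, and let $\mathbf c_{ij}$, $\mathbf w_{ij}$, $\mathbf a_{ij}$ be the operators $|i\rangle\langle j|$ in the respective label. A $3\times3$ matrix acts on the span of the $|n\rangle$, $n=0,1,2$; its entries are operators on the other labels. Let $E_{ij}$ ($i,j\in\{0,1,2\}$) be the matrix units, and put $u=\mathbf a_{00}\mathbf c^-\mathbf w^+$, $\pi=\mathbf a_{11}\mathbf w_{00}$, $$X^{\mathrm L}_0=E_{00}+E_{20}+(\mathbf a_{00}+\mathbf a_{01}\mathbf c^++\mathbf a_{11}\mathbf c^+\mathbf w^++\pi)E_{10},$$ $$X^{\mathrm L}_1=E_{01}+(\mathbf a_{00}+\mathbf a_{01}+\mathbf a_{11}\mathbf w^++\pi)(E_{12}+E_{22}),$$ $$Y^{\mathrm L}_0=(u+\mathbf a_{11}\mathbf w^++\pi)(E_{00}+E_{20})+\big(u+\mathbf a_{01}\mathbf w^++\mathbf a_{11}\mathbf c^+(\mathbf w^+)^2+\mathbf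 a_{11}\mathbf c^+\mathbf w_{10}+\pi\big)E_{10},$$ $$Y^{\mathrm L}_1=(u+\mathbf a_{11}\mathbf w^++\pi)E_{01}+(u+\mathbf a_{11}\mathbf c^+\mathbf w^++\pi)(E_{12}+E_{22}),$$ $$(X^{\mathrm R}_0)^T=X^{\mathrm L}_0-\mathbf c_{10}\big(\mathbf a_{01}\mathbf w_{11}+\mathbf a_{11}(\mathbf w_{10}+\mathbf w_{21})\big)E_{10},\qquad (X^{\mathrm R}_1)^T=X^{\mathrm L}_1,$$ $$(Y^{\mathrm R}_0)^T=Y^{\mathrm L}_0-\mathbf a_{11}\mathbf c_{10}(\mathbf w_{10}+\mathbf w_{20})E_{10},\qquad (Y^{\mathrm R}_1)^T=Y^{\mathrm L}_1-\mathbf a_{11}\mathbf c_{10}(\mathbf w_{10}+\mathbf w_{21})(E_{12}+E_{22}).$$ The boundary vectors are $\langle L^{\mathrm L}(t)|=\langle0,t,0,0|$, $|R^{\mathrm L}\rangle=\sum_{n=0}^2|0,0,n,1\rangle$, $\langle L^{\mathrm R}|=\langle R^{\mathrm L}|+\langle0,1,0,1|+\langle0,1,2,1|$, $|R^{\mathrm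 R}(t)\rangle=|0,t+1,0,0\rangle$. Set $$c^{\mathrm L}_{\underline s}(t)=\langle L^{\mathrm L}(t)|X^{\mathrm L}_{s_{-t}}Y^{\mathrm L}_{s_{-t+1}}X^{\mathrm L}_{s_{-t+2}}\cdots X^{\mathrm L}_{s_t}|R^{\mathrm L}\rangle,\qquad c^{\mathrm R}_{\underline s}(t)=\langle L^{\mathrm R}|X^{\mathrm R}_{s_{-t}}Y^{\mathrm R}_{s_{-t+1}}X^{\mathrm R}_{s_{-t+2}}\cdots X^{\mathrm R}_{s_t}|R^{\mathrm R}(t)\rangle .$$ *Claim.* 1. For all even $n$ and all $t$ with $1\le t<n/2$, $$\rho(t)=\sum_{\underline s\in\{0,1\}^{2t+1}}\big(c^{\mathrm L}_{\underline s}(t)+c^{\mathrm R}_{\underline s}(t)\big)\,|\underline s\rangle\langle\underline s| .$$ 2. Let $n,t$ be as in 1, and let $\underline s$ be the restriction to the sites $-t,\dots,t$ of the configuration at time $t$ that evolves from a configuration $S$ of the chain at time $0$ (even sites are updated in the first step, odd sites in the second, and so on). Then $c^{\mathrm L}_{\underline s}(t)=1$ if at time $0$ there is a left-moving soliton at the origin,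 possibly in the process of scattering, that is $(S_{-1},S_0,S_1)\in\{(1,1,0),(0,1,0),(1,1,1)\}$, and $c^{\mathrm L}_{\underline s}(t)=0$ otherwise; $c^{\mathrm R}_{\underline s}(t)=1$ if at time $0$ there is a right-moving soliton at the origin that is not scattering, that is $(S_{-1},S_0,S_1)=(0,1,1)$, and $c^{\mathrm R}_{\underline s}(t)=0$ otherwise. 3. For $0\le t\le T$ neither $c^{\mathrm L}_{\underline s}(t)$ nor $c^{\mathrm R}_{\underline s}(t)$ changes if $\mathcal V$ and the operators are truncated to $0\le c,w\le T+1$ (in the definitions of the ladder operators and projectors only these values of $c$ and $w$ are kept). The truncated auxiliary space has dimension $6(T+2)^2=O(T^2)$. -/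

import Mathlib

open Asymptotics

namespace Rule54

noncomputable section

/-! ## The cellular automaton on a periodic chain -/

/-- The local update rule with binary code 54. -/
def chi (s₁ s₂ s₃ : ZMod 2) : ZMod 2 := s₁ + s₂ + s₃ + s₁ * s₃

/-- Configurations of a periodic chain of `n` sites; the site labels
`-n/2+1, …, n/2` are read modulo `n`. -/
abbrev Config (n : ℕ) : Type := ZMod n → ZMod 2

open Classical in
/-- Simultaneous update of all even sites (`n` is even wherever this is used, so that the
parity of a site is well defined). -/
def stepEven {n : ℕ} (S : Config n) : Config n := fun x =>
  if Even x then chi (S (x - 1)) (S x) (S (x + 1)) else S x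

open Classical in
/-- Simultaneous update of all odd sites. -/
def stepOdd {n : ℕ} (S : Config n) : Config n := fun x =>
  if Even x then S x else chi (S (x - 1)) (S x) (S (x + 1))

/-- The configuration at time `t` that evolves from `S`; in the first time step the even sites
are updated. -/
def evolve {n : ℕ} : ℕ → Config n → Config n
  | 0, S => S
  | t + 1, S => if Even t then stepEven (evolve t S) else stepOdd (evolve t S)

/-- Operators on the `2 ^ n`-dimensional space of macroscopic states. -/
abbrev Operator (n : ℕ) : Type := Matrix (Config n) (Config n) ℝ

open Classical in
/-- The operator that sends the basis state of `S` to the basis state of `f S`. -/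
def mapOperator {n : ℕ} (f : Config n → Config n) : Operator n :=
  Matrix.of fun S' S => if S' = f S then 1 else 0

/-- The one-step propagator for even sites. -/
def Ue (n : ℕ) : Operator n := mapOperator stepEven

/-- The one-step propagator for odd sites. -/
def Uo (n : ℕ) : Operator n := mapOperator stepOdd

/-- Time evolution of observables: `a(0) = a`, and `a(t+1)` is `Ue a(t) Ue` for even `t` and
`Uo a(t) Uo` for odd `t`. -/
def heisenberg {n : ℕ} [NeZero n] (a : Operator n) : ℕ → Operator n
  | 0 => a
  | t + 1 => if Even t then Ue n * heisenberg a t * Ue n else Uo n * heisenberg a t * Uo n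

open Classical in
/-- The projector onto the local state `b` at the site `x`. -/
def siteProj (n : ℕ) (b : ZMod 2) (x : ZMod n) : Operator n :=
  Matrix.diagonal fun S => if S x = b then 1 else 0

/-- The local density in the centre of the chain, at time `t`. -/
def rho (n : ℕ) [NeZero n] (t : ℕ) : Operator n := heisenberg (siteProj n 1 0) t

/-- Configurations `(s₋ₜ, …, sₜ)` on the section `[-t, t]`; the entry with index `k` belongs to
the site `k - t`. -/
abbrev Section (t : ℕ) : Type := Fin (2 * t + 1) → ZMod 2

/-- The restriction of a configuration of the chain to the section `[-t, t]`. -/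
def restrict {n : ℕ} (t : ℕ) (S : Config n) : Section t :=
  fun k => S (((k : ℕ) : ZMod n) - (t : ZMod n))

open Classical in
/-- The projector onto the configuration `s` on the section `[-t, t]`. -/
def sectionProj (n t : ℕ) (s : Section t) : Operator n :=
  Matrix.diagonal fun S => if restrict t S = s then 1 else 0

/-- At time `0` a left-moving soliton is at the origin: it is alone (first case), or in the
process of scattering with a right-moving one (last two cases). -/
def LeftMoverAtOrigin {n : ℕ} (S : Config n) : Prop :=
  (S (-1) = 1 ∧ S 0 = 1 ∧ S 1 = 0) ∨ (S (-1) = 0 ∧ S 0 = 1 ∧ S 1 = 0) ∨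
    (S (-1) = 1 ∧ S 0 = 1 ∧ S 1 = 1)

/-- At time `0` there is a right-moving soliton at the origin that is not scattering. -/
def RightMoverAtOrigin {n : ℕ} (S : Config n) : Prop :=
  S (-1) = 0 ∧ S 0 = 1 ∧ S 1 = 1

instance {n : ℕ} (S : Config n) : Decidable (LeftMoverAtOrigin S) := by
  unfold LeftMoverAtOrigin; infer_instance

instance {n : ℕ} (S : Config n) : Decidable (RightMoverAtOrigin S) := by
  unfold RightMoverAtOrigin; infer_instance

/-! ## The auxiliary space

Everything below depends on a bound `N : ℕ∞` for the values of `c` and `w`. The value `N = ⊤`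
gives the infinite-dimensional auxiliary space, a finite value its truncation to `0 ≤ c, w ≤ N`. -/

/-- The values that `c` and `w` may take. -/
abbrev Level (N : ℕ∞) : Type := {k : ℕ // (k : ℕ∞) ≤ N}

/-- The labels `(c, w, n, a)` of the basis vectors. -/
abbrev Label (N : ℕ∞) : Type := Level N × Level N × Fin 3 × Fin 2

/-- The auxiliary space. -/
abbrev Aux (N : ℕ∞) : Type := Label N →₀ ℝ

/-- Linear operators on the auxiliary space. -/
abbrev AuxOp (N : ℕ∞) : Type := Module.End ℝ (Aux N)

variable {N : ℕ∞}

open Classical in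
/-- The basis vector `|c, w, n, a⟩`; it is `0` if the values of `c`, `w` are out of range. -/
def ket (c w : ℕ) (n : Fin 3) (a : Fin 2) : Aux N :=
  if h : (c : ℕ∞) ≤ N ∧ (w : ℕ∞) ≤ N then Finsupp.single (⟨c, h.1⟩, ⟨w, h.2⟩, n, a) 1 else 0

/-- The linear operator that sends every basis vector `|c, w, n, a⟩` to `f c w n a`. -/
def opOf (f : ℕ → ℕ → Fin 3 → Fin 2 → Aux N) : AuxOp N :=
  Finsupp.linearCombination ℝ fun i : Label N => f i.1 i.2.1 i.2.2.1 i.2.2.2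

/-- The ladder operator that raises `c`. -/
def cUp : AuxOp N := opOf fun c w n a => ket (c + 1) w n a

/-- The ladder operator that lowers `c`, the transpose of `cUp`. -/
def cDown : AuxOp N := opOf fun c w n a => if c = 0 then 0 else ket (c - 1) w n a

/-- The ladder operator that raises `w`. -/
def wUp : AuxOp N := opOf fun c w n a => ket c (w + 1) n a

/-- `∑ |c₁, w, n, a⟩⟨c₂, w, n, a|` over `w, n, a`. -/
def cP (c₁ c₂ : ℕ) : AuxOp N := opOf fun c w n a => if c = c₂ then ket c₁ w n a else 0

/-- `∑ |c, w₁, n, a⟩⟨c, w₂, n, a|` over `c, n, a`. -/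
def wP (w₁ w₂ : ℕ) : AuxOp N := opOf fun c w n a => if w = w₂ then ket c w₁ n a else 0

/-- `∑ |c, w, n₁, a⟩⟨c, w, n₂, a|` over `c, w, a`. -/
def nP (n₁ n₂ : Fin 3) : AuxOp N := opOf fun c w n a => if n = n₂ then ket c w n₁ a else 0

/-- `∑ |c, w, n, a₁⟩⟨c, w, n, a₂|` over `c, w, n`. -/
def aP (a₁ a₂ : Fin 2) : AuxOp N := opOf fun c w n a => if a = a₂ then ket c w n a₁ else 0

/-- The operator given by a `3 × 3` matrix that acts on the span of the `|n⟩` and whose entries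
are operators on the remaining degrees of freedom `c, w, a`. -/
def block (M : Matrix (Fin 3) (Fin 3) (AuxOp N)) : AuxOp N :=
  ∑ i, ∑ j, nP i j * M i j

/-- The matrix element `⟨i| A |j⟩` between basis vectors. -/
def entry (A : AuxOp N) (i j : Label N) : ℝ := A (Finsupp.single j 1) i

open Classical in
/-- The transpose of an operator whose rows have finitely many nonzero entries, see
`entry_transpose`. All operators below are of this kind, see `entry_XR` and `entry_YR`. -/
def transpose (A : AuxOp N) : AuxOp N :=
  Finsupp.linearCombination ℝ fun j : Label N =>
    if h : (Function.support fun i => entry A j i).Finite then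
      Finsupp.ofSupportFinite (fun i => entry A j i) h
    else 0

/-- The matrix element `⟨u| A |v⟩`. -/
def mel (u : Aux N) (A : AuxOp N) (v : Aux N) : ℝ := u.sum fun i x => x * (A v) i

/-! ## The operators and boundary vectors of the matrix products -/

def XL0 : AuxOp N :=
  block !![1, 0, 0;
    aP 0 0 + aP 0 1 * cUp + aP 1 1 * cUp * wUp, 0, 0;
    1, 0, 0]
  + aP 1 1 * wP 0 0 * block !![0, 0, 0; 1, 0, 0; 0, 0, 0]

def XL1 : AuxOp N :=
  block !![0, 1, 0;
    0, 0, aP 0 0 + aP 0 1 + aP 1 1 * wUp;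
    0, 0, aP 0 0 + aP 0 1 + aP 1 1 * wUp]
  + aP 1 1 * wP 0 0 * block !![0, 0, 0; 0, 0, 1; 0, 0, 1]

def YL0 : AuxOp N :=
  block !![aP 0 0 * cDown * wUp + aP 1 1 * wUp, 0, 0;
    aP 0 0 * cDown * wUp + aP 0 1 * wUp + aP 1 1 * cUp * wUp ^ 2, 0, 0;
    aP 0 0 * cDown * wUp + aP 1 1 * wUp, 0, 0]
  + aP 1 1 * block !![wP 0 0, 0, 0;
    cUp * wP 1 0 + wP 0 0, 0, 0;
    wP 0 0, 0, 0]

def YL1 : AuxOp N :=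
  block !![0, aP 0 0 * cDown * wUp + aP 1 1 * wUp, 0;
    0, 0, aP 0 0 * cDown * wUp + aP 1 1 * cUp * wUp;
    0, 0, aP 0 0 * cDown * wUp + aP 1 1 * cUp * wUp]
  + aP 1 1 * wP 0 0 * block !![0, 1, 0; 0, 0, 1; 0, 0, 1]

def XL (s : ZMod 2) : AuxOp N := if s = 0 then XL0 else XL1

def YL (s : ZMod 2) : AuxOp N := if s = 0 then YL0 else YL1

/-- The transpose of the operator `XR 0`. -/
def XR0T : AuxOp N :=
  XL0 - cP 1 0 * (aP 0 1 * wP 1 1 + aP 1 1 * (wP 1 0 + wP 2 1))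
    * block !![0, 0, 0; 1, 0, 0; 0, 0, 0]

/-- The transpose of the operator `YR 0`. -/
def YR0T : AuxOp N :=
  YL0 - aP 1 1 * cP 1 0 * (wP 1 0 + wP 2 0) * block !![0, 0, 0; 1, 0, 0; 0, 0, 0]

/-- The transpose of the operator `YR 1`. -/
def YR1T : AuxOp N :=
  YL1 - aP 1 1 * cP 1 0 * (wP 1 0 + wP 2 1) * block !![0, 0, 0; 0, 0, 1; 0, 0, 1]

def XR (s : ZMod 2) : AuxOp N := if s = 0 then transpose XR0T else transpose XL1

def YR (s : ZMod 2) : AuxOp N := if s = 0 then transpose YR0T else transpose YR1T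

def leftL (t : ℕ) : Aux N := ket 0 t 0 0

def rightL : Aux N := ∑ n : Fin 3, ket 0 0 n 1

def leftR : Aux N := rightL + ket 0 1 0 1 + ket 0 1 2 1

def rightR (t : ℕ) : Aux N := leftL (t + 1)

/-- The product `X_{s₋ₜ} Y_{s₋ₜ₊₁} X_{s₋ₜ₊₂} ⋯ X_{sₜ}`. -/
def word {t : ℕ} (X Y : ZMod 2 → AuxOp N) (s : Section t) : AuxOp N :=
  (List.ofFn fun k : Fin (2 * t + 1) => if Even (k : ℕ) then X (s k) else Y (s k)).prod

/-- The contribution of left-movers, with auxiliary space bounded by `N`. -/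
def cL (N : ℕ∞) (t : ℕ) (s : Section t) : ℝ :=
  mel (N := N) (leftL t) (word XL YL s) rightL

/-- The contribution of right-movers, with auxiliary space bounded by `N`. -/
def cR (N : ℕ∞) (t : ℕ) (s : Section t) : ℝ :=
  mel (N := N) leftR (word XR YR s) (rightR t)

/-! ## The transposes above are genuine -/

/-- Every row of `A` has finitely many nonzero entries. -/
def RowFinite (A : AuxOp N) : Prop := ∀ i, (Function.support fun j => entry A i j).Finite

theorem entry_transpose {A : AuxOp N} (hA : RowFinite A) (i j : Label N) :
    entry (transpose A) i j = entry A j i := by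
  have h := hA j
  have e : transpose A (Finsupp.single j 1) =
      Finsupp.ofSupportFinite (fun i => entry A j i) h := by
    unfold transpose
    rw [Finsupp.linearCombination_single, one_smul, dif_pos h]
  change transpose A (Finsupp.single j 1) i = _
  rw [e]
  rfl

theorem RowFinite.add {A B : AuxOp N} (hA : RowFinite A) (hB : RowFinite B) :
    RowFinite (A + B) := fun i =>
  ((hA i).union (hB i)).subset (Function.support_add _ _)

theorem RowFinite.sub {A B : AuxOp N} (hA : RowFinite A) (hB : RowFinite B) :
    RowFinite (A - B) := fun i =>
  ((hA i).union (hB i)).subset (Function.support_sub _ _)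

theorem RowFinite.zero : RowFinite (0 : AuxOp N) := fun i => by
  simp [entry, Function.support]

theorem RowFinite.one : RowFinite (1 : AuxOp N) := fun i => by
  refine (Set.finite_singleton i).subset fun j hj => ?_
  by_contra h
  exact hj (by simpa [entry] using Finsupp.single_eq_of_ne (fun e => h e.symm))

theorem RowFinite.mul {A B : AuxOp N} (hA : RowFinite A) (hB : RowFinite B) :
    RowFinite (A * B) := fun i => by
  refine ((hA i).biUnion fun k _ => hB k).subset fun j hj => ?_
  have e : entry (A * B) i j = (B (Finsupp.single j 1)).sum fun k x => x * entry A i k := by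
    conv_lhs => rw [entry, Module.End.mul_apply, ← Finsupp.sum_single (B (Finsupp.single j 1))]
    simp only [Finsupp.sum, map_sum, Finsupp.coe_finsetSum, Finset.sum_apply]
    refine Finset.sum_congr rfl fun k _ => ?_
    rw [← mul_one ((B (Finsupp.single j 1)) k), ← smul_eq_mul, ← Finsupp.smul_single, map_smul]
    simp [entry]
  rw [Function.mem_support, e] at hj
  obtain ⟨k, _, hk⟩ := Finset.exists_ne_zero_of_sum_ne_zero hj
  exact Set.mem_biUnion (Function.mem_support.2 (right_ne_zero_of_mul hk))
    (Function.mem_support.2 (left_ne_zero_of_mul hk))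

theorem RowFinite.sum {ι : Type*} {s : Finset ι} {A : ι → AuxOp N}
    (h : ∀ i ∈ s, RowFinite (A i)) : RowFinite (∑ i ∈ s, A i) := by
  classical
  induction s using Finset.induction_on with
  | empty => simpa using RowFinite.zero
  | insert a s ha ih =>
    rw [Finset.sum_insert ha]
    exact (h a (Finset.mem_insert_self a s)).add
      (ih fun i hi => h i (Finset.mem_insert_of_mem hi))

theorem ket_apply_ne {c w : ℕ} {n : Fin 3} {a : Fin 2} {i : Label N}
    (h : (ket c w n a : Aux N) i ≠ 0) :
    (i.1 : ℕ) = c ∧ (i.2.1 : ℕ) = w ∧ i.2.2.1 = n ∧ i.2.2.2 = a := by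
  unfold ket at h
  split_ifs at h with h'
  · by_cases e : i = (⟨c, h'.1⟩, ⟨w, h'.2⟩, n, a)
    · subst e; simp
    · exact absurd (Finsupp.single_eq_of_ne e) h
  · simp at h

/-- An operator each of whose nonzero entries changes `c` and `w` by a bounded amount is
row finite. -/
theorem RowFinite.opOf {f : ℕ → ℕ → Fin 3 → Fin 2 → Aux N} (B : ℕ)
    (h : ∀ c w n a (i : Label N), f c w n a i ≠ 0 → c ≤ i.1 + B ∧ w ≤ i.2.1 + B) :
    RowFinite (opOf f) := fun i => by
  have hinj : Function.Injective
      (fun j : Label N => ((j.1 : ℕ), (j.2.1 : ℕ), j.2.2.1, j.2.2.2)) := by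
    rintro ⟨⟨c, _⟩, ⟨w, _⟩, n, a⟩ ⟨⟨c', _⟩, ⟨w', _⟩, n', a'⟩ e
    simp only [Prod.mk.injEq] at e
    obtain ⟨rfl, rfl, rfl, rfl⟩ := e
    rfl
  refine Set.Finite.subset
    (((Set.finite_Iic ((i.1 : ℕ) + B)).prod
      ((Set.finite_Iic ((i.2.1 : ℕ) + B)).prod
        (Set.finite_univ (α := Fin 3 × Fin 2)))).preimage hinj.injOn) fun j hj => ?_
  have hj' : f j.1 j.2.1 j.2.2.1 j.2.2.2 i ≠ 0 := by
    simpa [entry, Rule54.opOf] using hj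
  have := h _ _ _ _ _ hj'
  simpa using this

theorem rowFinite_cUp : RowFinite (cUp : AuxOp N) :=
  RowFinite.opOf 0 fun c w n a i h => by have := ket_apply_ne h; omega

theorem rowFinite_cDown : RowFinite (cDown : AuxOp N) :=
  RowFinite.opOf 1 fun c w n a i h => by
    split_ifs at h with h'
    · simp at h
    · have := ket_apply_ne h; omega

theorem rowFinite_wUp : RowFinite (wUp : AuxOp N) :=
  RowFinite.opOf 0 fun c w n a i h => by have := ket_apply_ne h; omega

theorem rowFinite_cP (x y : ℕ) : RowFinite (cP x y : AuxOp N) :=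
  RowFinite.opOf y fun c w n a i h => by
    split_ifs at h with h'
    · have := ket_apply_ne h; omega
    · simp at h

theorem rowFinite_wP (x y : ℕ) : RowFinite (wP x y : AuxOp N) :=
  RowFinite.opOf y fun c w n a i h => by
    split_ifs at h with h'
    · have := ket_apply_ne h; omega
    · simp at h

theorem rowFinite_nP (x y : Fin 3) : RowFinite (nP x y : AuxOp N) :=
  RowFinite.opOf 0 fun c w n a i h => by
    split_ifs at h with h'
    · have := ket_apply_ne h; omega
    · simp at h

theorem rowFinite_aP (x y : Fin 2) : RowFinite (aP x y : AuxOp N) :=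
  RowFinite.opOf 0 fun c w n a i h => by
    split_ifs at h with h'
    · have := ket_apply_ne h; omega
    · simp at h

theorem RowFinite.block {M : Matrix (Fin 3) (Fin 3) (AuxOp N)} (h : ∀ i j, RowFinite (M i j)) :
    RowFinite (block M) :=
  RowFinite.sum fun i _ => RowFinite.sum fun j _ => (rowFinite_nP i j).mul (h i j)

theorem rowFinite_XL0 : RowFinite (XL0 : AuxOp N) := by
  refine RowFinite.add (.block fun i j => ?_)
    (.mul ((rowFinite_aP _ _).mul (rowFinite_wP _ _)) (.block fun i j => ?_)) <;>
  fin_cases i <;> fin_cases j <;>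
  simp [RowFinite.zero, RowFinite.one]
  all_goals
    repeat' first
      | with_reducible exact RowFinite.zero
      | with_reducible exact RowFinite.one
      | with_reducible exact rowFinite_aP _ _
      | with_reducible exact rowFinite_cP _ _
      | with_reducible exact rowFinite_wP _ _
      | with_reducible exact rowFinite_cUp
      | with_reducible exact rowFinite_cDown
      | with_reducible exact rowFinite_wUp
      | with_reducible apply RowFinite.add
      | with_reducible apply RowFinite.mul

theorem rowFinite_XL1 : RowFinite (XL1 : AuxOp N) := by
  refine RowFinite.add (.block fun i j => ?_)
    (.mul ((rowFinite_aP _ _).mul (rowFinite_wP _ _)) (.block fun i j => ?_)) <;>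
  fin_cases i <;> fin_cases j <;>
  simp [RowFinite.zero, RowFinite.one]
  all_goals
    repeat' first
      | with_reducible exact RowFinite.zero
      | with_reducible exact RowFinite.one
      | with_reducible exact rowFinite_aP _ _
      | with_reducible exact rowFinite_cP _ _
      | with_reducible exact rowFinite_wP _ _
      | with_reducible exact rowFinite_cUp
      | with_reducible exact rowFinite_cDown
      | with_reducible exact rowFinite_wUp
      | with_reducible apply RowFinite.add
      | with_reducible apply RowFinite.mul

theorem rowFinite_YL0 : RowFinite (YL0 : AuxOp N) := by
  refine RowFinite.add (.block fun i j => ?_)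
    (.mul (rowFinite_aP _ _) (.block fun i j => ?_)) <;>
  fin_cases i <;> fin_cases j <;>
  simp [RowFinite.zero, pow_two, rowFinite_wP]
  all_goals
    repeat' first
      | with_reducible exact RowFinite.zero
      | with_reducible exact RowFinite.one
      | with_reducible exact rowFinite_aP _ _
      | with_reducible exact rowFinite_cP _ _
      | with_reducible exact rowFinite_wP _ _
      | with_reducible exact rowFinite_cUp
      | with_reducible exact rowFinite_cDown
      | with_reducible exact rowFinite_wUp
      | with_reducible apply RowFinite.add
      | with_reducible apply RowFinite.mul

theorem rowFinite_YL1 : RowFinite (YL1 : AuxOp N) := by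
  refine RowFinite.add (.block fun i j => ?_)
    (.mul ((rowFinite_aP _ _).mul (rowFinite_wP _ _)) (.block fun i j => ?_)) <;>
  fin_cases i <;> fin_cases j <;>
  simp [RowFinite.zero, RowFinite.one]
  all_goals
    repeat' first
      | with_reducible exact RowFinite.zero
      | with_reducible exact RowFinite.one
      | with_reducible exact rowFinite_aP _ _
      | with_reducible exact rowFinite_cP _ _
      | with_reducible exact rowFinite_wP _ _
      | with_reducible exact rowFinite_cUp
      | with_reducible exact rowFinite_cDown
      | with_reducible exact rowFinite_wUp
      | with_reducible apply RowFinite.add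
      | with_reducible apply RowFinite.mul

theorem rowFinite_XR0T : RowFinite (XR0T : AuxOp N) := by
  refine rowFinite_XL0.sub (.mul ?_ (.block fun i j => ?_))
  · repeat' first
      | with_reducible exact RowFinite.zero
      | with_reducible exact RowFinite.one
      | with_reducible exact rowFinite_aP _ _
      | with_reducible exact rowFinite_cP _ _
      | with_reducible exact rowFinite_wP _ _
      | with_reducible exact rowFinite_cUp
      | with_reducible exact rowFinite_cDown
      | with_reducible exact rowFinite_wUp
      | with_reducible apply RowFinite.add
      | with_reducible apply RowFinite.mul
  · fin_cases i <;> fin_cases j <;> simp [RowFinite.zero, RowFinite.one]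

theorem rowFinite_YR0T : RowFinite (YR0T : AuxOp N) := by
  refine rowFinite_YL0.sub (.mul ?_ (.block fun i j => ?_))
  · repeat' first
      | with_reducible exact RowFinite.zero
      | with_reducible exact RowFinite.one
      | with_reducible exact rowFinite_aP _ _
      | with_reducible exact rowFinite_cP _ _
      | with_reducible exact rowFinite_wP _ _
      | with_reducible exact rowFinite_cUp
      | with_reducible exact rowFinite_cDown
      | with_reducible exact rowFinite_wUp
      | with_reducible apply RowFinite.add
      | with_reducible apply RowFinite.mul
  · fin_cases i <;> fin_cases j <;> simp [RowFinite.zero, RowFinite.one]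

theorem rowFinite_YR1T : RowFinite (YR1T : AuxOp N) := by
  refine rowFinite_YL1.sub (.mul ?_ (.block fun i j => ?_))
  · repeat' first
      | with_reducible exact RowFinite.zero
      | with_reducible exact RowFinite.one
      | with_reducible exact rowFinite_aP _ _
      | with_reducible exact rowFinite_cP _ _
      | with_reducible exact rowFinite_wP _ _
      | with_reducible exact rowFinite_cUp
      | with_reducible exact rowFinite_cDown
      | with_reducible exact rowFinite_wUp
      | with_reducible apply RowFinite.add
      | with_reducible apply RowFinite.mul
  · fin_cases i <;> fin_cases j <;> simp [RowFinite.zero, RowFinite.one]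

theorem entry_XR (s : ZMod 2) (i j : Label N) :
    entry (XR s) i j = entry (if s = 0 then XR0T else XL1) j i := by
  unfold XR
  split_ifs
  · exact entry_transpose rowFinite_XR0T i j
  · exact entry_transpose rowFinite_XL1 i j

theorem entry_YR (s : ZMod 2) (i j : Label N) :
    entry (YR s) i j = entry (if s = 0 then YR0T else YR1T) j i := by
  unfold YR
  split_ifs
  · exact entry_transpose rowFinite_YR0T i j
  · exact entry_transpose rowFinite_YR1T i j

end

end Rule54

namespace Rule54

noncomputable section

set_option linter.unusedSimpArgs false

/-! Both matrix products count the accepted runs of one nondeterministic counter automaton, `val`.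
Its label n is the number of trailing 1s read so far, capped at 2. While a = 0, every second symbol
moves one unit from w to c, so c measures the distance from the edge of the light cone. A jump to a
= 1 guesses the soliton that started at the origin. From then on each scattering partner found
lowers c by one while w runs down, and acceptance requires c = 0: the displacement of the soliton
must equal the number of its scatterings. Transposing the operators reverses the order of reading,
so the right-moving term is the same automaton run on the mirror image, with initial w larger by one
and with corrections, switched on by the flag `r`, that drop the scattering pairs already counted as
left-movers (`cL_eq_val`, `cR_eq_val`).

The heart is `val_pull`: the number of accepted runs does not change when the section at one time is
replaced by the section, two sites shorter, one step earlier. It follows from comparing the two runs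
site pair by site pair, starting at the far end of the word; `Matched` lists the identities for runs
that have jumped, `MatchedBefore` those for runs that have not. As each time step is an involution,
`val_evolve` then leads back to t = 1, where only three sites matter and eight cases decide which
solitons are counted.

The rest is soft. The indicators of the two kinds of soliton add up to the indicator of a 1 at the
origin, and conjugating a diagonal operator by the propagators composes its diagonal with the
backward dynamics. No transition raises c + w (`next_le`), so truncation loses nothing. -/

/-! ### The counting automaton -/

/-- Labels `(c, w, n, a)` without a bound on `c` and `w`. -/
abbrev State : Type := ℕ × ℕ × Fin 3 × Fin 2

/-- The possible states after a soliton has been counted, which lowers `c` by one and `w` by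
`k`, unless `w` is already exhausted. -/
def scatter (r : Bool) (k c w : ℕ) (n : Fin 3) : List State :=
  if w = 0 then [(c, 0, n, 1)]
  -- The exclusion for `r` reflects the subtracted terms of `XR0T`, `YR0T` and `YR1T`: all of their
  -- rows with a = 1 have c = 1 and w equal to 1 or 2. Truncated subtraction in `w - k` is intended:
  -- for k = 2, w = 1 it is the entry `cUp * wP 1 0` of `YL0`.
  else if c = 0 ∨ (r = true ∧ c = 1 ∧ w ≤ 2) then [] else [(c - 1, w - k, n, 1)]

/-- The nonzero entries of the row of `X s` (of the transpose of `XR s` if `r`). -/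
def nextX (r : Bool) (s : ZMod 2) : State → List State
  | (c, w, n, a) =>
    if s = 0 then
      if n = 1 then
        if a = 0 then
          (c, w, 0, 0) ::
            -- The exclusion at c = w = 1 is the subtracted term with `aP 0 1 * wP 1 1`.
            if c = 0 ∨ (r = true ∧ c = 1 ∧ w = 1) then [] else [(c - 1, w, 0, 1)]
        else scatter r 1 c w 0
      else [(c, w, 0, a)]
    else
      if n = 0 then [(c, w, 1, a)]
      else if a = 0 then [(c, w, 2, 0), (c, w, 2, 1)]
      -- For w = 0 the truncated difference is again 0, so this one entry merges `wUp` with the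
      -- projector `wP 0 0`.
      else [(c, w - 1, 2, 1)]

/-- The nonzero entries of the row of `Y s` (of the transpose of `YR s` if `r`). -/
def nextY (r : Bool) (s : ZMod 2) : State → List State
  | (c, w, n, a) =>
    if a = 0 then
      if w = 0 then []
      else if s = 0 then
        (c + 1, w - 1, 0, 0) :: if n = 1 then [(c, w - 1, 0, 1)] else []
      else [(c + 1, w - 1, if n = 0 then 1 else 2, 0)]
    else if s = 0 then
      if n = 1 then scatter r 2 c w 0 else [(c, w - 1, 0, 1)]
    else
      if n = 0 then [(c, w - 1, 1, 1)] else scatter r 1 c w 2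

def next (r odd : Bool) (s : ZMod 2) (i : State) : List State :=
  if odd then nextY r s i else nextX r s i

/-- The number of accepted runs of the automaton. -/
def val (r : Bool) : Bool → List (ZMod 2) → State → ℕ
  | _, [], (c, w, n, a) =>
    -- The alternative for `r` comes from the two additional basis vectors in `leftR`.
    if a = 1 ∧ c = 0 ∧ (w = 0 ∨ (r = true ∧ w = 1 ∧ n ≠ 1)) then 1 else 0
  | odd, s :: u, i => ((next r odd s i).map (val r (!odd) u)).sum

theorem zmod_two (s : ZMod 2) : s = 0 ∨ s = 1 := by revert s; decide

/-- Once w = 0 and a = 1, only the projector terms act: there is a single transition, and it keeps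
c. The remaining symbols therefore no longer matter. -/
theorem val_exhausted (r odd : Bool) (u : List (ZMod 2)) (c : ℕ) (n : Fin 3) :
    val r odd u (c, 0, n, 1) = if c = 0 then 1 else 0 := by
  induction u generalizing odd n with
  | nil => simp [val]
  | cons s u ih =>
    rcases zmod_two s with rfl | rfl <;> cases odd <;> fin_cases n <;>
      simp [val, next, nextX, nextY, scatter, ih]

/-- The number of accepted runs that start by counting a soliton. -/
def hit (r : Bool) (k : ℕ) (odd : Bool) (u : List (ZMod 2)) (c w : ℕ) (n : Fin 3) : ℕ :=
  if w = 0 then val r odd u (c, 0, n, 1)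
  else if c = 0 ∨ (r = true ∧ c = 1 ∧ w ≤ 2) then 0 else val r odd u (c - 1, w - k, n, 1)

section Equations

variable (r : Bool) (u : List (ZMod 2)) (c w : ℕ) (a : Fin 2)

theorem sum_scatter (k : ℕ) (odd : Bool) (n : Fin 3) :
    ((scatter r k c w n).map (val r odd u)).sum = hit r k odd u c w n := by
  unfold scatter hit
  split_ifs <;> simp

theorem val_X_zero_zero : val r false (0 :: u) (c, w, 0, a) = val r true u (c, w, 0, a) := by
  simp [val, next, nextX]

theorem val_X_zero_two : val r false (0 :: u) (c, w, 2, a) = val r true u (c, w, 0, a) := by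
  simp [val, next, nextX]

theorem val_X_zero_one : val r false (0 :: u) (c, w, 1, 1) = hit r 1 true u c w 0 := by
  simp [val, next, nextX, sum_scatter]

theorem val_X_one_zero : val r false (1 :: u) (c, w, 0, a) = val r true u (c, w, 1, a) := by
  simp [val, next, nextX]

theorem val_X_one_one : val r false (1 :: u) (c, w, 1, 1) = val r true u (c, w - 1, 2, 1) := by
  simp [val, next, nextX]

theorem val_X_one_two : val r false (1 :: u) (c, w, 2, 1) = val r true u (c, w - 1, 2, 1) := by
  simp [val, next, nextX]

theorem val_Y_zero_zero : val r true (0 :: u) (c, w, 0, 1) = val r false u (c, w - 1, 0, 1) := by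
  simp [val, next, nextY]

theorem val_Y_zero_one : val r true (0 :: u) (c, w, 1, 1) = hit r 2 false u c w 0 := by
  simp [val, next, nextY, sum_scatter]

theorem val_Y_zero_two : val r true (0 :: u) (c, w, 2, 1) = val r false u (c, w - 1, 0, 1) := by
  simp [val, next, nextY]

theorem val_Y_one_zero : val r true (1 :: u) (c, w, 0, 1) = val r false u (c, w - 1, 1, 1) := by
  simp [val, next, nextY]

theorem val_Y_one_one : val r true (1 :: u) (c, w, 1, 1) = hit r 1 false u c w 2 := by
  simp [val, next, nextY, sum_scatter]

theorem val_Y_one_two : val r true (1 :: u) (c, w, 2, 1) = hit r 1 false u c w 2 := by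
  simp [val, next, nextY, sum_scatter]

end Equations

/-! ### Comparing consecutive times after the jump -/

/-- The configuration one time step earlier, right of two sites with values `p` and `q`. -/
def pull (p q : ZMod 2) : List (ZMod 2) → List (ZMod 2)
  | [] => []
  | [x] => [chi p q x]
  | x :: y :: u => chi p q x :: x :: pull x y u

theorem chi_eqs : (chi 0 0 0 = 0 ∧ chi 0 0 1 = 1 ∧ chi 0 1 0 = 1 ∧ chi 0 1 1 = 0) ∧
    (chi 1 0 0 = 1 ∧ chi 1 0 1 = 1 ∧ chi 1 1 0 = 0 ∧ chi 1 1 1 = 0) := by decide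

/-- The runs of the automaton at times `t + 1` and `t` after the jump. -/
structure Matched (r : Bool) (m : ℕ) (u : List (ZMod 2)) : Prop where
  -- The first two digits of a field name are the symbols p, q just read at the later time; the
  -- earlier word has only p in common with them. For p = q = 1 a third digit gives the label n of
  -- the earlier run. The bounds on w hold along all relevant runs: with 2m + 1 symbols left, w is
  -- exactly `m + r.toNat` before the jump, and each later Y lowers a positive w by at least one.
  h00 : ∀ c w, w ≤ m + r.toNat →
    val r false u (c, w, 0, 1) = val r false (pull 0 0 u) (c, w, 0, 1)
  h01 : ∀ c w, w ≤ m + r.toNat →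
    val r false u (c, w, 1, 1) = val r false (pull 0 1 u) (c, w, 0, 1)
  h112 : ∀ c w, w ≤ m + r.toNat →
    val r false u (c, w, 2, 1) = val r false (pull 1 1 u) (c, w, 2, 1)
  h10 : ∀ c w n, n ≠ 0 → w ≤ m ∨ (r = true ∧ w = m + 1 ∧ c ≠ 0) →
    val r false u (c, w, 0, 1) = val r false (pull 1 0 u) (c, w + 1, n, 1)
  h111 : ∀ c w, w ≤ m + r.toNat → (r = true → c ≠ 0 ∨ 2 ≤ w) →
    val r false u (c, w, 2, 1) = val r false (pull 1 1 u) (c + 1, w + 1, 1, 1)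

theorem fin_three {n : Fin 3} (h : n ≠ 0) : n = 1 ∨ n = 2 := by revert n; decide

theorem matched_single (r : Bool) (x : ZMod 2) : Matched r 0 [x] := by
  constructor
  · intro c w
    rcases zmod_two x with rfl | rfl <;> cases r <;> simp [val, next, nextX, pull, chi_eqs]
  · intro c w
    rcases zmod_two x with rfl | rfl <;> cases r <;>
      simp [val, next, nextX, scatter, pull, chi_eqs] <;> grind [val]
  · intro c w
    rcases zmod_two x with rfl | rfl <;> cases r <;>
      simp [val, next, nextX, scatter, pull, chi_eqs] <;> grind [val]
  · intro c w n hn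
    rcases fin_three hn with rfl | rfl <;> rcases zmod_two x with rfl | rfl <;> cases r <;>
      simp [val, next, nextX, scatter, pull, chi_eqs] <;> grind [val]
  · intro c w
    rcases zmod_two x with rfl | rfl <;> cases r <;>
      simp [val, next, nextX, scatter, pull, chi_eqs] <;> grind [val]

/-- Since `chi 1 1 x = 0` for both x, the pulled word begins with 0, and reading it at n = 1 forces
a scattering that is not allowed here. This settles the case that `Matched.h111` leaves out. -/
theorem val_pull_one_one {r : Bool} {u : List (ZMod 2)} {c w : ℕ} (hu : u ≠ []) (hw : w ≠ 0)
    (hc : c = 0 ∨ (r = true ∧ c = 1 ∧ w ≤ 2)) : val r false (pull 1 1 u) (c, w, 1, 1) = 0 := by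
  obtain ⟨v, hv⟩ : ∃ v, pull 1 1 u = 0 :: v := by
    rcases u with _ | ⟨x, _ | ⟨y, u⟩⟩
    · exact absurd rfl hu
    · rcases zmod_two x with rfl | rfl <;> simp [pull, chi_eqs]
    · rcases zmod_two x with rfl | rfl <;> simp [pull, chi_eqs]
  rw [hv, val_X_zero_one, hit, if_neg hw, if_pos hc]

/-- Two symbols on the left turn each identity into identities for `u`, or into cases where both
sides are exhausted or dead. -/
theorem Matched.cons {r : Bool} {m : ℕ} {u : List (ZMod 2)} (h : Matched r m u) (hu : u ≠ [])
    (x y : ZMod 2) : Matched r (m + 1) (x :: y :: u) := by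
  obtain ⟨h00, h01, h112, h10, h111⟩ := h
  obtain ⟨k, hk, hr, hk1⟩ : ∃ k, r.toNat = k ∧ (r = true ↔ k = 1) ∧ k ≤ 1 :=
    ⟨_, rfl, by cases r <;> simp⟩
  rw [hk] at h00 h01 h112 h111
  simp only [hr] at h10 h111
  -- The hypotheses are restated with independent counters on both sides, so that matching counters
  -- and checking bounds become one problem of linear arithmetic.
  have e00 : ∀ c c' w w', w ≤ m + k ∧ c = c' ∧ w = w' →
      val r false u (c, w, 0, 1) = val r false (pull 0 0 u) (c', w', 0, 1) := by
    rintro c _ w _ ⟨h, rfl, rfl⟩; exact h00 c w h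
  have e01 : ∀ c c' w w', w ≤ m + k ∧ c = c' ∧ w = w' →
      val r false u (c, w, 1, 1) = val r false (pull 0 1 u) (c', w', 0, 1) := by
    rintro c _ w _ ⟨h, rfl, rfl⟩; exact h01 c w h
  have e112 : ∀ c c' w w', w ≤ m + k ∧ c = c' ∧ w = w' →
      val r false u (c, w, 2, 1) = val r false (pull 1 1 u) (c', w', 2, 1) := by
    rintro c _ w _ ⟨h, rfl, rfl⟩; exact h112 c w h
  have e10 : ∀ c c' w w' n, n ≠ 0 →
      -- The alternative with both widths 0 absorbs truncated subtraction; there `val_exhausted`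
      -- makes the words irrelevant.
      (w ≤ m ∨ (k = 1 ∧ w = m + 1 ∧ c ≠ 0)) ∧ c = c' ∧ (w' = w + 1 ∨ w = 0 ∧ w' = 0) →
      val r false u (c, w, 0, 1) = val r false (pull 1 0 u) (c', w', n, 1) := by
    rintro c _ w _ n hn ⟨h, rfl, rfl | ⟨rfl, rfl⟩⟩
    · exact h10 c w n hn h
    · simp only [val_exhausted]
  have e111 : ∀ c c' w w', (w ≤ m + k ∧ (k = 1 → c ≠ 0 ∨ 2 ≤ w)) ∧ c' = c + 1 ∧ w' = w + 1 →
      val r false u (c, w, 2, 1) = val r false (pull 1 1 u) (c', w', 1, 1) := by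
    rintro c _ w _ ⟨h, rfl, rfl⟩; exact h111 c w h.1 h.2
  have exh : ∀ v v' c c' w w' n n', c = c' ∧ w = 0 ∧ w' = 0 →
      val r false v (c, w, n, 1) = val r false v' (c', w', n', 1) := by
    rintro v v' c _ _ _ n n' ⟨rfl, rfl, rfl⟩; simp only [val_exhausted]
  have dead : ∀ c w, w ≠ 0 ∧ (c = 0 ∨ (k = 1 ∧ c = 1 ∧ w ≤ 2)) →
      val r false (pull 1 1 u) (c, w, 1, 1) = 0 := by
    rintro c w ⟨hw, hc⟩
    exact val_pull_one_one hu hw (by rwa [hr])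
  constructor <;> simp only [hr, hk]
  · intro c w hw
    rcases zmod_two x with rfl | rfl <;> rcases zmod_two y with rfl | rfl <;>
      simp only [pull, chi_eqs, val_X_zero_zero, val_X_zero_one, val_X_zero_two, val_X_one_zero,
        val_X_one_one, val_X_one_two, val_Y_zero_zero, val_Y_zero_one, val_Y_zero_two,
        val_Y_one_zero, val_Y_one_one, val_Y_one_two, hit, hr,
        Nat.add_eq_zero_iff, one_ne_zero, and_false, false_or, if_false]
    all_goals try split_ifs
    all_goals first
      | omega
      | exact e00 _ _ _ _ (by omega)
      | exact e01 _ _ _ _ (by omega)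
      | exact e112 _ _ _ _ (by omega)
      | exact e10 _ _ _ _ _ (by decide) (by omega)
  · intro c w hw
    rcases zmod_two x with rfl | rfl <;> rcases zmod_two y with rfl | rfl <;>
      simp only [pull, chi_eqs, val_X_zero_zero, val_X_zero_one, val_X_zero_two, val_X_one_zero,
        val_X_one_one, val_X_one_two, val_Y_zero_zero, val_Y_zero_one, val_Y_zero_two,
        val_Y_one_zero, val_Y_one_one, val_Y_one_two, hit, hr,
        Nat.add_eq_zero_iff, one_ne_zero, and_false, false_or, if_false]
    all_goals try split_ifs
    all_goals first
      | omega
      | exact e00 _ _ _ _ (by omega)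
      | exact e01 _ _ _ _ (by omega)
      | exact e112 _ _ _ _ (by omega)
      | exact e10 _ _ _ _ _ (by decide) (by omega)
      | exact e111 _ _ _ _ (by omega)
      | exact (dead _ _ (by omega)).symm
      | exact exh _ _ _ _ _ _ _ _ (by omega)
  · intro c w hw
    rcases zmod_two x with rfl | rfl <;> rcases zmod_two y with rfl | rfl <;>
      simp only [pull, chi_eqs, val_X_zero_zero, val_X_zero_one, val_X_zero_two, val_X_one_zero,
        val_X_one_one, val_X_one_two, val_Y_zero_zero, val_Y_zero_one, val_Y_zero_two,
        val_Y_one_zero, val_Y_one_one, val_Y_one_two, hit, hr,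
        Nat.add_eq_zero_iff, one_ne_zero, and_false, false_or, if_false]
    all_goals try split_ifs
    all_goals first
      | omega
      | exact e00 _ _ _ _ (by omega)
      | exact e01 _ _ _ _ (by omega)
      | exact e112 _ _ _ _ (by omega)
      | exact e10 _ _ _ _ _ (by decide) (by omega)
      | exact e111 _ _ _ _ (by omega)
      | exact (dead _ _ (by omega)).symm
      | exact exh _ _ _ _ _ _ _ _ (by omega)
  · intro c w n hn hw
    rcases fin_three hn with rfl | rfl <;>
    rcases zmod_two x with rfl | rfl <;> rcases zmod_two y with rfl | rfl <;>
      simp only [pull, chi_eqs, val_X_zero_zero, val_X_zero_one, val_X_zero_two, val_X_one_zero,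
        val_X_one_one, val_X_one_two, val_Y_zero_zero, val_Y_zero_one, val_Y_zero_two,
        val_Y_one_zero, val_Y_one_one, val_Y_one_two, hit, hr,
        Nat.add_eq_zero_iff, one_ne_zero, and_false, false_or, if_false]
    all_goals try split_ifs
    all_goals first
      | omega
      | exact e00 _ _ _ _ (by omega)
      | exact e01 _ _ _ _ (by omega)
      | exact e112 _ _ _ _ (by omega)
      | exact e10 _ _ _ _ _ (by decide) (by omega)
  · intro c w hw hc
    rcases zmod_two x with rfl | rfl <;> rcases zmod_two y with rfl | rfl <;>
      simp only [pull, chi_eqs, val_X_zero_zero, val_X_zero_one, val_X_zero_two, val_X_one_zero,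
        val_X_one_one, val_X_one_two, val_Y_zero_zero, val_Y_zero_one, val_Y_zero_two,
        val_Y_one_zero, val_Y_one_one, val_Y_one_two, hit, hr,
        Nat.add_eq_zero_iff, one_ne_zero, and_false, false_or, if_false]
    all_goals try split_ifs
    all_goals first
      | omega
      | exact e00 _ _ _ _ (by omega)
      | exact e01 _ _ _ _ (by omega)
      | exact e112 _ _ _ _ (by omega)
      | exact e10 _ _ _ _ _ (by decide) (by omega)
      | exact e111 _ _ _ _ (by omega)
      | exact (dead _ _ (by omega)).symm
      | exact exh _ _ _ _ _ _ _ _ (by omega)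
-- Runs before the jump, and invariance of the count
section Equations

variable (r : Bool) (u : List (ZMod 2)) (c w : ℕ)

/-- The number of accepted runs that start with a jump at an even site. -/
def jump (r : Bool) (u : List (ZMod 2)) (c w : ℕ) : ℕ :=
  if c = 0 ∨ (r = true ∧ c = 1 ∧ w = 1) then 0 else val r true u (c - 1, w, 0, 1)

theorem val_X_zero_one' :
    val r false (0 :: u) (c, w, 1, 0) = val r true u (c, w, 0, 0) + jump r u c w := by
  unfold jump
  simp only [val, next, nextX]
  split_ifs <;> simp_all

theorem val_X_one_one' : val r false (1 :: u) (c, w, 1, 0) =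
    val r true u (c, w, 2, 0) + val r true u (c, w, 2, 1) := by
  simp [val, next, nextX]

theorem val_X_one_two' : val r false (1 :: u) (c, w, 2, 0) =
    val r true u (c, w, 2, 0) + val r true u (c, w, 2, 1) := by
  simp [val, next, nextX]

theorem val_Y_zero_zero' :
    val r true (0 :: u) (c, w + 1, 0, 0) = val r false u (c + 1, w, 0, 0) := by
  simp [val, next, nextY]

theorem val_Y_zero_one' : val r true (0 :: u) (c, w + 1, 1, 0) =
    val r false u (c + 1, w, 0, 0) + val r false u (c, w, 0, 1) := by
  simp [val, next, nextY]

theorem val_Y_zero_two' :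
    val r true (0 :: u) (c, w + 1, 2, 0) = val r false u (c + 1, w, 0, 0) := by
  simp [val, next, nextY]

theorem val_Y_one_zero' :
    val r true (1 :: u) (c, w + 1, 0, 0) = val r false u (c + 1, w, 1, 0) := by
  simp [val, next, nextY]

theorem val_Y_one_one' :
    val r true (1 :: u) (c, w + 1, 1, 0) = val r false u (c + 1, w, 2, 0) := by
  simp [val, next, nextY]

theorem val_Y_one_two' :
    val r true (1 :: u) (c, w + 1, 2, 0) = val r false u (c + 1, w, 2, 0) := by
  simp [val, next, nextY]

end Equations

/-- The runs of the automaton at times `t + 1` and `t` before the jump. -/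
structure MatchedBefore (r : Bool) (m : ℕ) (u : List (ZMod 2)) : Prop where
  h00 : ∀ c, val r false u (c + 1, m + r.toNat, 0, 0) =
    val r false (pull 0 0 u) (c, m + r.toNat, 0, 0)
  h01 : ∀ c, (r = false → c + m ≠ 0) → val r false u (c + 1, m + r.toNat, 1, 0) =
    val r false (pull 0 1 u) (c, m + r.toNat, 0, 0)
  h112 : ∀ c, val r false u (c + 1, m + r.toNat, 2, 0) =
    val r false (pull 1 1 u) (c, m + r.toNat, 2, 0)
  -- The added term counts runs which at the later time jump while reading the preceding pair. It is
  -- expressed through the earlier word because, at this w, `Matched.h10` requires c ≠ 0 when `r` is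
  -- set. The added term of `h111` has the same origin.
  h10 : ∀ c n, n ≠ 0 → val r false u (c + 1, m + r.toNat, 0, 0) +
    val r false (pull 1 0 u) (c, m + r.toNat + 1, n, 1) =
      val r false (pull 1 0 u) (c, m + r.toNat, n, 0)
  h111 : ∀ c, val r false u (c + 1, m + r.toNat, 2, 0) +
    val r false (pull 1 1 u) (c, m + r.toNat + 1, 1, 1) =
      val r false (pull 1 1 u) (c, m + r.toNat, 1, 0)

theorem matchedBefore_single (r : Bool) (x : ZMod 2) : MatchedBefore r 0 [x] := by
  constructor
  · intro c
    rcases zmod_two x with rfl | rfl <;> cases r <;> simp [val, next, nextX, pull, chi_eqs]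
  · intro c hc
    rcases zmod_two x with rfl | rfl <;> cases r <;> rcases c with _ | c <;>
      simp [val, next, nextX, pull, chi_eqs] at hc ⊢
  · intro c
    rcases zmod_two x with rfl | rfl <;> cases r <;> simp [val, next, nextX, pull, chi_eqs]
  · intro c n hn
    rcases fin_three hn with rfl | rfl <;> rcases zmod_two x with rfl | rfl <;> cases r <;>
      simp [val, next, nextX, pull, chi_eqs]
  · intro c
    rcases zmod_two x with rfl | rfl <;> cases r <;> rcases c with _ | _ | c <;>
      simp [val, next, nextX, scatter, pull, chi_eqs]

theorem MatchedBefore.cons {r : Bool} {m : ℕ} {u : List (ZMod 2)} (h : MatchedBefore r m u)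
    (h' : Matched r m u) (hu : u ≠ []) (x y : ZMod 2) :
    MatchedBefore r (m + 1) (x :: y :: u) := by
  obtain ⟨z00, z01, z112, z10, z111⟩ := h
  have hw : m + 1 + r.toNat = m + r.toNat + 1 := by omega
  have p00 := fun c => h'.h00 c _ le_rfl
  have p01 := fun c => h'.h01 c _ le_rfl
  have p10 : ∀ c n, n ≠ 0 → val r false u (c + 1, m + r.toNat, 0, 1) =
      val r false (pull 1 0 u) (c + 1, m + r.toNat + 1, n, 1) := fun c n hn =>
    h'.h10 (c + 1) _ n hn (by cases r <;> simp)
  -- In the case excluded from `Matched.h111` both sides vanish.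
  have p111 : ∀ c, hit r 1 false u (c + 1) (m + r.toNat + 1) 2 =
      val r false (pull 1 1 u) (c + 1, m + r.toNat + 1, 1, 1) := fun c => by
    unfold hit
    by_cases hc : r = true ∧ c = 0 ∧ m + r.toNat ≤ 1
    · rw [val_pull_one_one hu (by omega) (by grind), if_neg (by omega), if_pos (by grind)]
    · rw [if_neg (by omega), if_neg (by grind)]
      exact h'.h111 c _ le_rfl (by grind)
  -- The exclusion in `jump` needs w = 1, but `r = true` makes the width here at least 2.
  have hj : ∀ v c, jump r v (c + 1) (m + r.toNat + 1) =
      val r true v (c, m + r.toNat + 1, 0, 1) := fun v c => by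
    rw [jump, if_neg (by rintro (h | ⟨rfl, h⟩) <;> simp at h), Nat.add_sub_cancel]
  constructor <;> rw [hw]
  all_goals clear h' hw
  all_goals generalize m + r.toNat = w at *
  · intro c
    have f01 := z01 (c + 1) (by omega)
    rcases zmod_two x with rfl | rfl <;> rcases zmod_two y with rfl | rfl <;>
      simp only [pull, chi_eqs, val_X_zero_zero, val_X_zero_one, val_X_zero_two, val_X_one_zero,
        val_X_one_one, val_X_one_two, val_Y_zero_zero, val_Y_zero_one, val_Y_zero_two,
        val_Y_one_zero, val_Y_one_one, val_Y_one_two, val_X_zero_one', val_X_one_one',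
        val_X_one_two', val_Y_zero_zero', val_Y_zero_one', val_Y_zero_two', val_Y_one_zero',
        val_Y_one_one', val_Y_one_two', Nat.add_sub_cancel, p111, hj]
    all_goals grind [jump, hit]
  · intro c hc
    have f01 := z01 (c + 1) (by omega)
    rcases zmod_two x with rfl | rfl <;> rcases zmod_two y with rfl | rfl <;>
      simp only [pull, chi_eqs, val_X_zero_zero, val_X_zero_one, val_X_zero_two, val_X_one_zero,
        val_X_one_one, val_X_one_two, val_Y_zero_zero, val_Y_zero_one, val_Y_zero_two,
        val_Y_one_zero, val_Y_one_one, val_Y_one_two, val_X_zero_one', val_X_one_one',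
        val_X_one_two', val_Y_zero_zero', val_Y_zero_one', val_Y_zero_two', val_Y_one_zero',
        val_Y_one_one', val_Y_one_two', Nat.add_sub_cancel, p111, hj]
    all_goals grind [jump, hit]
  · intro c
    have f01 := z01 (c + 1) (by omega)
    rcases zmod_two x with rfl | rfl <;> rcases zmod_two y with rfl | rfl <;>
      simp only [pull, chi_eqs, val_X_zero_zero, val_X_zero_one, val_X_zero_two, val_X_one_zero,
        val_X_one_one, val_X_one_two, val_Y_zero_zero, val_Y_zero_one, val_Y_zero_two,
        val_Y_one_zero, val_Y_one_one, val_Y_one_two, val_X_zero_one', val_X_one_one',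
        val_X_one_two', val_Y_zero_zero', val_Y_zero_one', val_Y_zero_two', val_Y_one_zero',
        val_Y_one_one', val_Y_one_two', Nat.add_sub_cancel, p111, hj]
    all_goals grind [jump, hit]
  · intro c n hn
    have f01 := z01 (c + 1) (by omega)
    rcases fin_three hn with rfl | rfl <;>
    rcases zmod_two x with rfl | rfl <;> rcases zmod_two y with rfl | rfl <;>
      simp only [pull, chi_eqs, val_X_zero_zero, val_X_zero_one, val_X_zero_two, val_X_one_zero,
        val_X_one_one, val_X_one_two, val_Y_zero_zero, val_Y_zero_one, val_Y_zero_two,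
        val_Y_one_zero, val_Y_one_one, val_Y_one_two, val_X_zero_one', val_X_one_one',
        val_X_one_two', val_Y_zero_zero', val_Y_zero_one', val_Y_zero_two', val_Y_one_zero',
        val_Y_one_one', val_Y_one_two', Nat.add_sub_cancel, p111, hj]
    all_goals grind [jump, hit]
  · intro c
    have f01 := z01 (c + 1) (by omega)
    rcases zmod_two x with rfl | rfl <;> rcases zmod_two y with rfl | rfl <;>
      simp only [pull, chi_eqs, val_X_zero_zero, val_X_zero_one, val_X_zero_two, val_X_one_zero,
        val_X_one_one, val_X_one_two, val_Y_zero_zero, val_Y_zero_one, val_Y_zero_two,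
        val_Y_one_zero, val_Y_one_one, val_Y_one_two, val_X_zero_one', val_X_one_one',
        val_X_one_two', val_Y_zero_zero', val_Y_zero_one', val_Y_zero_two', val_Y_one_zero',
        val_Y_one_one', val_Y_one_two', Nat.add_sub_cancel, p111, hj]
    all_goals grind [jump, hit]

theorem matched (r : Bool) (m : ℕ) (u : List (ZMod 2)) (hu : u.length = 2 * m + 1) :
    Matched r m u ∧ MatchedBefore r m u := by
  induction m generalizing u with
  | zero =>
    obtain ⟨x, rfl⟩ := List.length_eq_one_iff.1 hu
    exact ⟨matched_single r x, matchedBefore_single r x⟩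
  | succ m ih =>
    obtain _ | ⟨x, _ | ⟨y, u⟩⟩ := u
    · simp at hu
    · simp at hu
    · have hl : u.length = 2 * m + 1 := by simp at hu; omega
      have hu' : u ≠ [] := by rintro rfl; simp at hl
      exact ⟨(ih u hl).1.cons hu' x y, (ih u hl).2.cons (ih u hl).1 hu' x y⟩

/-- The number of accepted runs is invariant under the time evolution. -/
theorem val_pull (r : Bool) (m : ℕ) (s₀ s₁ s₂ s₃ : ZMod 2) (u : List (ZMod 2))
    (hu : u.length = 2 * m + 1) :
    val r false (s₀ :: s₁ :: s₂ :: s₃ :: u) (0, m + r.toNat + 2, 0, 0) =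
      val r false (pull s₀ s₁ (s₂ :: s₃ :: u)) (0, m + r.toNat + 1, 0, 0) := by
  obtain ⟨h', z00, z01, z112, z10, z111⟩ := matched r m u hu
  have hu' : u ≠ [] := by rintro rfl; simp at hu
  have p00 := fun c => h'.h00 c _ le_rfl
  have p01 := fun c => h'.h01 c _ le_rfl
  have p10 : ∀ c n, n ≠ 0 → val r false u (c + 1, m + r.toNat, 0, 1) =
      val r false (pull 1 0 u) (c + 1, m + r.toNat + 1, n, 1) := fun c n hn =>
    h'.h10 (c + 1) _ n hn (by cases r <;> simp)
  have p111 : ∀ c, hit r 1 false u (c + 1) (m + r.toNat + 1) 2 =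
      val r false (pull 1 1 u) (c + 1, m + r.toNat + 1, 1, 1) := fun c => by
    unfold hit
    by_cases hc : r = true ∧ c = 0 ∧ m + r.toNat ≤ 1
    · rw [val_pull_one_one hu' (by omega) (by grind), if_neg (by omega), if_pos (by grind)]
    · rw [if_neg (by omega), if_neg (by grind)]
      exact h'.h111 c _ le_rfl (by grind)
  have hj : ∀ v c, jump r v (c + 1) (m + r.toNat + 1) =
      val r true v (c, m + r.toNat + 1, 0, 1) := fun v c => by
    rw [jump, if_neg (by rintro (h | ⟨rfl, h⟩) <;> simp at h), Nat.add_sub_cancel]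
  -- The four leading symbols contain two Y, which raise c from 0 to 2; the pulled prefix contains
  -- one. Hence the identities are needed at c = 1.
  have f00 := z00 1
  have f01 := z01 1 (by omega)
  have f112 := z112 1
  have f10 := z10 1 1 (by decide)
  have f10' := z10 1 2 (by decide)
  have f111 := z111 1
  clear h' z00 z01 z112 z10 z111
  generalize m + r.toNat = w at *
  rcases zmod_two s₀ with rfl | rfl <;> rcases zmod_two s₁ with rfl | rfl <;>
  rcases zmod_two s₂ with rfl | rfl <;> rcases zmod_two s₃ with rfl | rfl <;>
      simp only [pull, chi_eqs, val_X_zero_zero, val_X_zero_one, val_X_zero_two, val_X_one_zero,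
        val_X_one_one, val_X_one_two, val_Y_zero_zero, val_Y_zero_one, val_Y_zero_two,
        val_Y_one_zero, val_Y_one_one, val_Y_one_two, val_X_zero_one', val_X_one_one',
        val_X_one_two', val_Y_zero_zero', val_Y_zero_one', val_Y_zero_two', val_Y_one_zero',
        val_Y_one_one', val_Y_one_two', Nat.add_sub_cancel, p111, hj, Nat.zero_add] <;>
      grind [jump, hit]

/-! ### Rows of the operators as transitions -/

variable {N : ℕ∞}

/-- The coordinate of a vector at a label, which is `0` out of range. -/
def coord (i : State) : Aux N →ₗ[ℝ] ℝ := by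
  classical exact
  if h : (i.1 : ℕ∞) ≤ N ∧ (i.2.1 : ℕ∞) ≤ N then
    Finsupp.lapply (⟨i.1, h.1⟩, ⟨i.2.1, h.2⟩, i.2.2.1, i.2.2.2)
  else 0

theorem ket_label (i : Label N) :
    (ket i.1 i.2.1 i.2.2.1 i.2.2.2 : Aux N) = Finsupp.single i 1 := by
  rw [ket, dif_pos ⟨i.1.2, i.2.1.2⟩]

theorem aux_ext {f g : Aux N →ₗ[ℝ] ℝ}
    (h : ∀ (c w : ℕ) n a, (c : ℕ∞) ≤ N → (w : ℕ∞) ≤ N → f (ket c w n a) = g (ket c w n a))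
    (v : Aux N) : f v = g v := by
  refine LinearMap.congr_fun (Finsupp.lhom_ext fun i x => ?_) v
  have := h i.1 i.2.1 i.2.2.1 i.2.2.2 i.1.2 i.2.1.2
  rw [ket_label] at this
  rw [← mul_one x, ← smul_eq_mul, ← Finsupp.smul_single, map_smul, map_smul, this]

theorem opOf_ket (f : ℕ → ℕ → Fin 3 → Fin 2 → Aux N) {c w : ℕ} (hc : (c : ℕ∞) ≤ N)
    (hw : (w : ℕ∞) ≤ N) (n : Fin 3) (a : Fin 2) : opOf f (ket c w n a) = f c w n a := by
  rw [ket, dif_pos ⟨hc, hw⟩, opOf, Finsupp.linearCombination_single, one_smul]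

open Classical in
theorem coord_ket (c w c' w' : ℕ) (n n' : Fin 3) (a a' : Fin 2) :
    coord (N := N) (c, w, n, a) (ket c' w' n' a') =
      if (c : ℕ∞) ≤ N ∧ (w : ℕ∞) ≤ N ∧ c = c' ∧ w = w' ∧ n = n' ∧ a = a' then 1 else 0 := by
  unfold coord ket
  by_cases h : (c : ℕ∞) ≤ N ∧ (w : ℕ∞) ≤ N
  · by_cases h' : (c' : ℕ∞) ≤ N ∧ (w' : ℕ∞) ≤ N
    · simp only [h, h', and_self, dif_pos, Finsupp.lapply_apply, Finsupp.single_apply,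
        Prod.mk.injEq, Subtype.mk.injEq, true_and]
      congr 1
      simp only [eq_comm]
    · rw [dif_neg h', if_neg (by rintro ⟨h1, h2, rfl, rfl, -⟩; exact h' ⟨h1, h2⟩), map_zero]
  · rw [dif_neg h, if_neg (by tauto)]
    rfl

theorem le_of_succ_le {c : ℕ} (h : ((c + 1 : ℕ) : ℕ∞) ≤ N) : (c : ℕ∞) ≤ N :=
  le_trans (by exact_mod_cast Nat.le_succ c) h

/-- The value `k` of `c` or `w` is in range. -/
def Fits (N : ℕ∞) (k : ℕ) : Prop := (k : ℕ∞) ≤ N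

theorem Fits.mono {k l : ℕ} (h : Fits N k) (hl : l ≤ k) : Fits N l :=
  le_trans (by exact_mod_cast hl) h

theorem Fits.sub {k : ℕ} (h : Fits N k) (l : ℕ) : Fits N (k - l) := h.mono (Nat.sub_le k l)

theorem Fits.zero : Fits N 0 := by simp [Fits]

section Rows

variable (v : Aux N) (c w : ℕ) (n : Fin 3) (a : Fin 2)

theorem coord_cUp (h : Fits N c) :
    coord (c, w, n, a) (cUp v) = if c = 0 then 0 else coord (c - 1, w, n, a) v := by
  have := aux_ext (f := (coord (c, w, n, a)).comp cUp)
    (g := if c = 0 then 0 else coord (c - 1, w, n, a)) (fun c' w' n' a' hc hw => ?_) v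
  · rw [LinearMap.comp_apply] at this
    rw [this]; split_ifs <;> rfl
  rw [LinearMap.comp_apply, cUp, opOf_ket _ hc hw]
  have := h.sub 1
  unfold Fits at *
  split_ifs <;> simp only [coord_ket, LinearMap.zero_apply, map_zero] <;> grind

theorem coord_cDown : coord (c, w, n, a) (cDown v) = coord (c + 1, w, n, a) v := by
  refine aux_ext (f := (coord (c, w, n, a)).comp cDown) (fun c' w' n' a' hc hw => ?_) v
  rw [LinearMap.comp_apply, cDown, opOf_ket _ hc hw, coord_ket]
  rcases c' with _ | c'
  · simp
  · have : (c + 1 = c' + 1) ↔ c = c' := by omega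
    simp only [Nat.succ_ne_zero, if_false, coord_ket, Nat.add_sub_cancel, this]
    congr 1
    refine propext ⟨fun h => ⟨?_, h.2⟩, fun h => ⟨le_of_succ_le h.1, h.2⟩⟩
    rw [h.2.2.1]; exact hc

theorem coord_wUp (h : Fits N w) :
    coord (c, w, n, a) (wUp v) = if w = 0 then 0 else coord (c, w - 1, n, a) v := by
  have := aux_ext (f := (coord (c, w, n, a)).comp wUp)
    (g := if w = 0 then 0 else coord (c, w - 1, n, a)) (fun c' w' n' a' hc hw => ?_) v
  · rw [LinearMap.comp_apply] at this
    rw [this]; split_ifs <;> rfl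
  rw [LinearMap.comp_apply, wUp, opOf_ket _ hc hw]
  have := h.sub 1
  unfold Fits at *
  split_ifs <;> simp only [coord_ket, LinearMap.zero_apply, map_zero] <;> grind

theorem coord_cP (x y : ℕ) (h : Fits N c) :
    coord (c, w, n, a) (cP x y v) = if c = x then coord (y, w, n, a) v else 0 := by
  have := aux_ext (f := (coord (c, w, n, a)).comp (cP x y))
    (g := if c = x then coord (y, w, n, a) else 0) (fun c' w' n' a' hc hw => ?_) v
  · rw [LinearMap.comp_apply] at this
    rw [this]; split_ifs <;> rfl
  rw [LinearMap.comp_apply, cP, opOf_ket _ hc hw]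
  unfold Fits at h
  split_ifs <;> simp only [coord_ket, LinearMap.zero_apply, map_zero] <;> grind

theorem coord_wP (x y : ℕ) (h : Fits N w) :
    coord (c, w, n, a) (wP x y v) = if w = x then coord (c, y, n, a) v else 0 := by
  have := aux_ext (f := (coord (c, w, n, a)).comp (wP x y))
    (g := if w = x then coord (c, y, n, a) else 0) (fun c' w' n' a' hc hw => ?_) v
  · rw [LinearMap.comp_apply] at this
    rw [this]; split_ifs <;> rfl
  rw [LinearMap.comp_apply, wP, opOf_ket _ hc hw]
  unfold Fits at h
  split_ifs <;> simp only [coord_ket, LinearMap.zero_apply, map_zero] <;> grind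

theorem coord_nP (x y : Fin 3) :
    coord (c, w, n, a) (nP x y v) = if n = x then coord (c, w, y, a) v else 0 := by
  have := aux_ext (f := (coord (c, w, n, a)).comp (nP x y))
    (g := if n = x then coord (c, w, y, a) else 0) (fun c' w' n' a' hc hw => ?_) v
  · rw [LinearMap.comp_apply] at this
    rw [this]; split_ifs <;> rfl
  rw [LinearMap.comp_apply, nP, opOf_ket _ hc hw]
  split_ifs <;> simp only [coord_ket, LinearMap.zero_apply, map_zero] <;> grind

theorem coord_aP (x y : Fin 2) :
    coord (c, w, n, a) (aP x y v) = if a = x then coord (c, w, n, y) v else 0 := by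
  have := aux_ext (f := (coord (c, w, n, a)).comp (aP x y))
    (g := if a = x then coord (c, w, n, y) else 0) (fun c' w' n' a' hc hw => ?_) v
  · rw [LinearMap.comp_apply] at this
    rw [this]; split_ifs <;> rfl
  rw [LinearMap.comp_apply, aP, opOf_ket _ hc hw]
  split_ifs <;> simp only [coord_ket, LinearMap.zero_apply, map_zero] <;> grind

theorem coord_block (M : Matrix (Fin 3) (Fin 3) (AuxOp N)) :
    coord (c, w, n, a) (block M v) = ∑ j, coord (c, w, j, a) (M n j v) := by
  simp only [block, LinearMap.sum_apply, map_sum, Module.End.mul_apply, coord_nP]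
  rw [Finset.sum_eq_single n] <;> simp +contextual [eq_comm]

end Rows

/-- The rows of the operator `A` are given by the transitions `f`. -/
def HasRows (A : AuxOp N) (f : State → List State) : Prop :=
  ∀ (c w : ℕ) n a v, Fits N c → Fits N w →
    coord (c, w, n, a) (A v) = ((f (c, w, n, a)).map fun i => coord i v).sum

theorem hasRows_XL0 : HasRows (XL0 : AuxOp N) (nextX false 0) := by
  intro c w n a v hc hw
  fin_cases n <;> fin_cases a <;>
    simp [XL0, nextX, scatter, coord_block, Fin.sum_univ_three, coord_aP, coord_wP, coord_cUp,
      coord_wUp, coord_cDown, hc, hw, Fits.sub, Fits.zero] <;> grind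

theorem hasRows_XL1 (r : Bool) : HasRows (XL1 : AuxOp N) (nextX r 1) := by
  intro c w n a v hc hw
  fin_cases n <;> fin_cases a <;>
    simp [XL1, nextX, scatter, coord_block, Fin.sum_univ_three, coord_aP, coord_wP, coord_cUp,
      coord_wUp, coord_cDown, hc, hw, Fits.sub, Fits.zero] <;> grind

theorem hasRows_YL0 : HasRows (YL0 : AuxOp N) (nextY false 0) := by
  intro c w n a v hc hw
  fin_cases n <;> fin_cases a <;>
    simp [YL0, nextY, scatter, coord_block, Fin.sum_univ_three, coord_aP, coord_wP, coord_cUp,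
      coord_wUp, coord_cDown, hc, hw, Fits.sub, Fits.zero, pow_two] <;> grind

theorem hasRows_YL1 : HasRows (YL1 : AuxOp N) (nextY false 1) := by
  intro c w n a v hc hw
  fin_cases n <;> fin_cases a <;>
    simp [YL1, nextY, scatter, coord_block, Fin.sum_univ_three, coord_aP, coord_wP, coord_cUp,
      coord_wUp, coord_cDown, hc, hw, Fits.sub, Fits.zero] <;> grind

theorem hasRows_XR0T : HasRows (XR0T : AuxOp N) (nextX true 0) := by
  intro c w n a v hc hw
  rw [XR0T, LinearMap.sub_apply, map_sub, hasRows_XL0 c w n a v hc hw]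
  fin_cases n <;> fin_cases a <;>
    simp [nextX, scatter, coord_block, Fin.sum_univ_three, coord_aP, coord_wP, coord_cP,
      hc, hw, Fits.zero] <;> grind

theorem hasRows_YR0T : HasRows (YR0T : AuxOp N) (nextY true 0) := by
  intro c w n a v hc hw
  rw [YR0T, LinearMap.sub_apply, map_sub, hasRows_YL0 c w n a v hc hw]
  fin_cases n <;> fin_cases a <;>
    simp [nextY, scatter, coord_block, Fin.sum_univ_three, coord_aP, coord_wP, coord_cP,
      hc, hw, Fits.zero]; grind

theorem hasRows_YR1T : HasRows (YR1T : AuxOp N) (nextY true 1) := by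
  intro c w n a v hc hw
  rw [YR1T, LinearMap.sub_apply, map_sub, hasRows_YL1 c w n a v hc hw]
  fin_cases n <;> fin_cases a <;>
    simp [nextY, scatter, coord_block, Fin.sum_univ_three, coord_aP, coord_wP, coord_cP,
      hc, hw, Fits.zero] <;> grind

/-! ### Matrix products as numbers of runs -/

/-- The alternating product of operators along a list of symbols. -/
def altProd (X Y : ZMod 2 → AuxOp N) : Bool → List (ZMod 2) → AuxOp N
  | _, [] => 1
  | odd, s :: u => (if odd then Y s else X s) * altProd X Y (!odd) u

/-- The alternating product of operators along a list of symbols, read from right to left. -/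
def altProdRev (X Y : ZMod 2 → AuxOp N) : Bool → List (ZMod 2) → AuxOp N
  | _, [] => 1
  | odd, s :: u => altProdRev X Y (!odd) u * (if odd then Y s else X s)

theorem prod_ofFn_eq_altProd (X Y : ZMod 2 → AuxOp N) (m b : ℕ) (f : Fin m → ZMod 2) :
    (List.ofFn fun k : Fin m => if Even ((k : ℕ) + b) then X (f k) else Y (f k)).prod =
      altProd X Y (decide ¬Even b) (List.ofFn f) := by
  induction m generalizing b with
  | zero => simp [altProd]
  | succ m ih =>
    have h := ih (b + 1) fun k => f k.succ
    rw [List.ofFn_succ, List.ofFn_succ, List.prod_cons, altProd]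
    have e : (!decide ¬Even b) = decide ¬Even (b + 1) := by
      by_cases hb : Even b <;> simp [hb, Nat.even_add_one]
    rw [e, ← h]
    congr 1
    · by_cases hb : Even b <;> simp [hb]
    · simp only [Fin.val_succ, add_assoc, add_comm 1 b]

theorem prod_ofFn_eq_altProdRev (X Y : ZMod 2 → AuxOp N) (m : ℕ) (f : Fin m → ZMod 2) :
    (List.ofFn fun k : Fin m => if Even (k : ℕ) then X (f k) else Y (f k)).prod =
      altProdRev X Y (decide (Even m)) (List.ofFn fun k => f k.rev) := by
  induction m with
  | zero => simp [altProdRev]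
  | succ m ih =>
    have h := ih fun k => f k.castSucc
    rw [List.ofFn_succ', List.concat_eq_append, List.prod_append, List.prod_singleton,
      List.ofFn_succ, altProdRev]
    have e : (!decide (Even (m + 1))) = decide (Even m) := by
      by_cases hb : Even m <;> simp [hb, Nat.even_add_one]
    rw [e]
    simp only [Fin.rev_succ, Fin.rev_zero, Fin.val_castSucc, Fin.val_last]
    rw [← h]
    congr 1
    by_cases hb : Even m <;> simp [hb, Nat.even_add_one]

theorem word_eq_altProd {t : ℕ} (X Y : ZMod 2 → AuxOp N) (s : Section t) :
    word X Y s = altProd X Y false (List.ofFn s) := by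
  simpa only [Nat.add_zero, Even.zero, not_true_eq_false, decide_false, word] using
    prod_ofFn_eq_altProd X Y (2 * t + 1) 0 s

theorem word_eq_altProdRev {t : ℕ} (X Y : ZMod 2 → AuxOp N) (s : Section t) :
    word X Y s = altProdRev X Y false (List.ofFn fun k => s k.rev) := by
  have h : decide (Even (2 * t + 1)) = false := by simp
  rw [← h]
  exact prod_ofFn_eq_altProdRev X Y (2 * t + 1) s

/-- This monotonicity is why truncation is harmless: a run from (0, t, 0, 0) or (0, t + 1, 0, 0)
never leaves the range c, w ≤ t + 1. -/
theorem next_le {r odd : Bool} {s : ZMod 2} {i j : State} (h : j ∈ next r odd s i) :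
    j.1 + j.2.1 ≤ i.1 + i.2.1 := by
  obtain ⟨c, w, n, a⟩ := i
  unfold next nextX nextY scatter at h
  dsimp only at h ⊢
  split_ifs at h <;> simp at h <;> grind

/-- The rows of `X s` and `Y s` are the transitions of the automaton. -/
theorem hasRows_next {X Y : ZMod 2 → AuxOp N} {r : Bool} (hX : ∀ s, HasRows (X s) (nextX r s))
    (hY : ∀ s, HasRows (Y s) (nextY r s)) (odd : Bool) (s : ZMod 2) :
    HasRows (if odd then Y s else X s) (next r odd s) := by
  cases odd
  · exact hX s
  · exact hY s

theorem cast_val_cons (r odd : Bool) (s : ZMod 2) (u : List (ZMod 2)) (i : State) :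
    (val r odd (s :: u) i : ℝ) = ((next r odd s i).map fun j => (val r (!odd) u j : ℝ)).sum := by
  simp [val, List.map_map, Function.comp_def]

theorem coord_altProd {X Y : ZMod 2 → AuxOp N} {r : Bool} (hX : ∀ s, HasRows (X s) (nextX r s))
    (hY : ∀ s, HasRows (Y s) (nextY r s)) {R : Aux N}
    (hR : ∀ odd i, Fits N (i.1 + i.2.1) → coord i R = val r odd [] i) (odd : Bool)
    (u : List (ZMod 2)) (i : State) (hi : Fits N (i.1 + i.2.1)) :
    coord i (altProd X Y odd u R) = val r odd u i := by
  induction u generalizing odd i with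
  | nil => exact hR odd i hi
  | cons s u ih =>
    rw [altProd, Module.End.mul_apply, cast_val_cons]
    refine (hasRows_next hX hY odd s i.1 i.2.1 i.2.2.1 i.2.2.2 _ (hi.mono (by omega))
      (hi.mono (by omega))).trans (congrArg List.sum (List.map_congr_left fun j hj => ?_))
    exact ih (!odd) j (hi.mono (next_le hj))

/-- A column of the transpose is a row of `A`; testing `HasRows` on each basis vector reads off its
entries. -/
theorem transpose_ket {A : AuxOp N} (hA : RowFinite A) {f : State → List State}
    (hf : HasRows A f) {c w : ℕ} (hc : Fits N c) (hw : Fits N w) (n : Fin 3) (a : Fin 2) :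
    transpose A (ket c w n a) =
      ((f (c, w, n, a)).map fun j => (ket j.1 j.2.1 j.2.2.1 j.2.2.2 : Aux N)).sum := by
  ext i
  have h := hf c w n a (Finsupp.single i 1) hc hw
  have e := entry_transpose hA i (⟨c, hc⟩, ⟨w, hw⟩, n, a)
  have e' : ∀ v : Aux N, coord (c, w, n, a) v = v (⟨c, hc⟩, ⟨w, hw⟩, n, a) := fun v => by
    rw [coord, dif_pos ⟨hc, hw⟩]; rfl
  rw [e'] at h
  rw [ket, dif_pos ⟨hc, hw⟩]
  refine (e.trans h).trans ?_
  rw [← Finsupp.lapply_apply (R := ℝ) i, map_list_sum, List.map_map]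
  refine congrArg List.sum (List.map_congr_left fun j _ => ?_)
  have e'' : ∀ v : Aux N, Finsupp.lapply (R := ℝ) i v = coord (i.1, i.2.1, i.2.2.1, i.2.2.2) v :=
    fun v => by rw [coord, dif_pos ⟨i.1.2, i.2.1.2⟩]
  rw [Function.comp_apply, e'', ← ket_label]
  obtain ⟨c', w', n', a'⟩ := j
  rw [coord_ket, coord_ket]
  have hi := i.1.2
  have hi' := i.2.1.2
  congr 1
  refine propext ⟨?_, ?_⟩
  · rintro ⟨_, _, h1, h2, h3, h4⟩
    exact ⟨hi, hi', h1.symm, h2.symm, h3.symm, h4.symm⟩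
  · rintro ⟨_, _, h1, h2, h3, h4⟩
    dsimp only at h1 h2
    exact ⟨by rwa [← h1], by rwa [← h2], h1.symm, h2.symm, h3.symm, h4.symm⟩

theorem apply_altProdRev {X Y : ZMod 2 → AuxOp N} {r : Bool}
    (h : ∀ odd s c w n a, Fits N c → Fits N w → (if odd then Y s else X s) (ket c w n a) =
      ((next r odd s (c, w, n, a)).map fun j => (ket j.1 j.2.1 j.2.2.1 j.2.2.2 : Aux N)).sum)
    {φ : Aux N →ₗ[ℝ] ℝ} (hφ : ∀ odd i, Fits N (i.1 + i.2.1) →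
      φ (ket i.1 i.2.1 i.2.2.1 i.2.2.2) = val r odd [] i) (odd : Bool)
    (u : List (ZMod 2)) (i : State) (hi : Fits N (i.1 + i.2.1)) :
    φ (altProdRev X Y odd u (ket i.1 i.2.1 i.2.2.1 i.2.2.2)) = val r odd u i := by
  induction u generalizing odd i with
  | nil => exact hφ odd i hi
  | cons s u ih =>
    rw [altProdRev, Module.End.mul_apply, cast_val_cons, h odd s _ _ _ _ (hi.mono (by omega))
      (hi.mono (by omega)), ← LinearMap.comp_apply, map_list_sum, List.map_map]
    exact congrArg List.sum (List.map_congr_left fun j hj => ih (!odd) j (hi.mono (next_le hj)))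

theorem mel_add (u u' : Aux N) (A : AuxOp N) (v : Aux N) :
    mel (u + u') A v = mel u A v + mel u' A v :=
  Finsupp.sum_add_index' (by simp) (by simp [add_mul])

theorem mel_ket (c w : ℕ) (n : Fin 3) (a : Fin 2) (A : AuxOp N) (v : Aux N) :
    mel (ket c w n a) A v = coord (c, w, n, a) (A v) := by
  unfold mel ket coord
  split_ifs with h
  · simp
  · simp

theorem hasRows_XL (s : ZMod 2) : HasRows (XL s : AuxOp N) (nextX false s) := by
  rcases zmod_two s with rfl | rfl
  · simpa [XL] using hasRows_XL0
  · simpa [XL] using hasRows_XL1 false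

theorem hasRows_YL (s : ZMod 2) : HasRows (YL s : AuxOp N) (nextY false s) := by
  rcases zmod_two s with rfl | rfl
  · simpa [YL] using hasRows_YL0
  · simpa [YL] using hasRows_YL1

theorem cL_eq_val {t : ℕ} (h : Fits N t) (s : Section t) :
    cL N t s = val false false (List.ofFn s) (0, t, 0, 0) := by
  rw [cL, leftL, mel_ket, word_eq_altProd]
  refine coord_altProd hasRows_XL hasRows_YL (fun odd i hi => ?_) _ _ _ (by simpa using h)
  obtain ⟨c, w, n, a⟩ := i
  have hc : (c : ℕ∞) ≤ N := hi.mono (by simp)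
  have hw : (w : ℕ∞) ≤ N := hi.mono (by simp)
  simp only [rightL, Fin.sum_univ_three, map_add, coord_ket, hc, hw, true_and, val]
  fin_cases n <;> by_cases hc : c = 0 <;> by_cases hw : w = 0 <;> by_cases ha : a = 1 <;>
    simp [hc, hw, ha]

theorem apply_XR_YR_ket (odd : Bool) (s : ZMod 2) (c w : ℕ) (n : Fin 3) (a : Fin 2)
    (hc : Fits N c) (hw : Fits N w) : (if odd then YR s else XR s) (ket c w n a) =
      ((next true odd s (c, w, n, a)).map fun j =>
        (ket j.1 j.2.1 j.2.2.1 j.2.2.2 : Aux N)).sum := by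
  cases odd <;> rcases zmod_two s with rfl | rfl
  · simpa [XR, next] using transpose_ket rowFinite_XR0T hasRows_XR0T hc hw n a
  · simpa [XR, next] using transpose_ket rowFinite_XL1 (hasRows_XL1 true) hc hw n a
  · simpa [YR, next] using transpose_ket rowFinite_YR0T hasRows_YR0T hc hw n a
  · simpa [YR, next] using transpose_ket rowFinite_YR1T hasRows_YR1T hc hw n a

/-- The product acts on the right boundary vector with the last site first, whence the reversed
word; pairing with `leftR` is the acceptance condition for `r = true`. -/
theorem cR_eq_val {t : ℕ} (h : Fits N (t + 1)) (s : Section t) :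
    cR N t s = val true false (List.ofFn fun k => s k.rev) (0, t + 1, 0, 0) := by
  have h1 : ((1 : ℕ) : ℕ∞) ≤ N := h.mono (by omega)
  have e : ∀ (A : AuxOp N) v, mel leftR A v =
      (coord (0, 0, 0, 1) + coord (0, 0, 1, 1) + coord (0, 0, 2, 1) + coord (0, 1, 0, 1) +
        coord (0, 1, 2, 1) : Aux N →ₗ[ℝ] ℝ) (A v) := fun A v => by
    simp only [leftR, rightL, Fin.sum_univ_three, mel_add, mel_ket, LinearMap.add_apply]
  rw [cR, e, word_eq_altProdRev]
  refine apply_altProdRev apply_XR_YR_ket (fun odd i hi => ?_) _ _ (0, t + 1, 0, 0)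
    (by simpa using h)
  obtain ⟨c, w, n, a⟩ := i
  have h0 : ((0 : ℕ) : ℕ∞) ≤ N := by simp
  simp only [LinearMap.add_apply, coord_ket, h0, h1, true_and, val]
  fin_cases n <;> rcases c with _ | c <;> rcases w with _ | _ | w <;> fin_cases a <;> simp

/-! ### The dynamics on the chain and the soliton counts -/

/-- The parity of the sites of a chain of even length. -/
def parity {n : ℕ} (hn : Even n) : ZMod n →+* ZMod 2 := ZMod.castHom hn.two_dvd (ZMod 2)

theorem even_iff_parity {n : ℕ} [NeZero n] (hn : Even n) (x : ZMod n) :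
    Even x ↔ parity hn x = 0 := by
  constructor
  · rintro ⟨y, rfl⟩
    rw [map_add, CharTwo.add_self_eq_zero]
  · intro h
    have h' : ((x.val : ℕ) : ZMod 2) = 0 := by
      rw [← h, ← map_natCast (parity hn), ZMod.natCast_zmod_val]
    rw [ZMod.natCast_eq_zero_iff_even] at h'
    obtain ⟨k, hk⟩ := h'
    exact ⟨k, by rw [← Nat.cast_add, ← hk, ZMod.natCast_zmod_val]⟩

open Classical in
/-- The time step from `t` to `t + 1`. -/
def step {n : ℕ} (t : ℕ) (S : Config n) : Config n :=
  if Even t then stepEven S else stepOdd S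

theorem step_apply {n : ℕ} [NeZero n] (hn : Even n) (t : ℕ) (S : Config n) (x : ZMod n) :
    step t S x = if parity hn x = t then chi (S (x - 1)) (S x) (S (x + 1)) else S x := by
  unfold step stepEven stepOdd
  by_cases ht : Even t
  · have : (t : ZMod 2) = 0 := (ZMod.natCast_eq_zero_iff_even).2 ht
    simp only [ht, if_true, even_iff_parity hn, this]
  · have : (t : ZMod 2) = 1 :=
      (ZMod.natCast_eq_one_iff_odd).2 (Nat.not_even_iff_odd.1 ht)
    simp only [ht, if_false, even_iff_parity hn, this]
    rcases zmod_two (parity hn x) with h | h <;> simp [h]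

theorem evolve_succ {n : ℕ} (t : ℕ) (S : Config n) : evolve (t + 1) S = step t (evolve t S) := by
  simp only [evolve, step]

theorem chi_chi (a b c : ZMod 2) : chi a (chi a b c) c = b := by
  revert a b c; decide

theorem chi_comm (a b c : ZMod 2) : chi a b c = chi c b a := by
  revert a b c; decide

/-- The neighbours of an updated site have the other parity and stay fixed, so `chi_chi` undoes the
update. -/
theorem step_step {n : ℕ} [NeZero n] (hn : Even n) (t : ℕ) (S : Config n) :
    step t (step t S) = S := by
  funext x
  simp only [step_apply hn, map_sub, map_add, map_one]
  by_cases h : parity hn x = t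
  · have h1 : ¬((t : ZMod 2) - 1 = t) := by simp
    have h2 : ¬((t : ZMod 2) + 1 = t) := by simp
    simp only [h, h1, h2, if_true, if_false, chi_chi]
  · simp only [h, if_false]

/-- The mirror image of a configuration. -/
def mirror {n : ℕ} (S : Config n) : Config n := fun x => S (-x)

theorem step_mirror {n : ℕ} [NeZero n] (hn : Even n) (t : ℕ) (S : Config n) :
    step t (mirror S) = mirror (step t S) := by
  funext x
  have h : -parity hn x = parity hn x := CharTwo.neg_eq _
  have h1 : -(x - 1) = -x + 1 := by ring
  have h2 : -(x + 1) = -x - 1 := by ring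
  simp only [mirror, step_apply hn, map_neg, h, h1, h2]
  rw [chi_comm]

theorem evolve_mirror {n : ℕ} [NeZero n] (hn : Even n) (t : ℕ) (S : Config n) :
    evolve t (mirror S) = mirror (evolve t S) := by
  induction t with
  | zero => rfl
  | succ t ih => rw [evolve_succ, evolve_succ, ih, step_mirror hn]

/-- The values at `m` consecutive sites, starting at `x`. -/
def line {n : ℕ} (S : Config n) : ZMod n → ℕ → List (ZMod 2)
  | _, 0 => []
  | x, m + 1 => S x :: line S (x + 1) m

theorem length_line {n : ℕ} (S : Config n) (x : ZMod n) (m : ℕ) : (line S x m).length = m := by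
  induction m generalizing x with
  | zero => rfl
  | succ m ih => rw [line, List.length_cons, ih]

theorem ofFn_eq_line {n : ℕ} (S : Config n) (x : ZMod n) (m : ℕ) :
    (List.ofFn fun k : Fin m => S (x + (k : ℕ))) = line S x m := by
  induction m generalizing x with
  | zero => rfl
  | succ m ih =>
    rw [List.ofFn_succ, line, ← ih]
    simp only [Fin.val_zero, Nat.cast_zero, add_zero, Fin.val_succ, Nat.cast_add, Nat.cast_one]
    congr 2
    funext k
    congr 1
    ring

theorem ofFn_restrict {n : ℕ} (t : ℕ) (S : Config n) :
    List.ofFn (restrict t S) = line S (-t) (2 * t + 1) := by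
  rw [← ofFn_eq_line]
  congr 1
  funext k
  exact congrArg S (by ring)

theorem ofFn_restrict_rev {n : ℕ} (t : ℕ) (S : Config n) :
    (List.ofFn fun k => restrict t S k.rev) = line (mirror S) (-t) (2 * t + 1) := by
  rw [← ofFn_eq_line]
  congr 1
  funext k
  refine congrArg S ?_
  have h : (k.rev : ℕ) + k = 2 * t := by rw [Fin.val_rev]; omega
  have h' : (((k.rev : ℕ) : ZMod n) + ((k : ℕ) : ZMod n)) = 2 * t := by
    exact_mod_cast congrArg (Nat.cast : ℕ → ZMod n) h
  linear_combination h'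

/-- Sites of the parity of t are updated and the others copied, which is the alternation built into
`pull`. -/
theorem pull_line {n : ℕ} [NeZero n] (hn : Even n) (t : ℕ) (S : Config n) (x : ZMod n) (m : ℕ)
    (hx : parity hn (x + 1) = t) :
    pull (S x) (S (x + 1)) (line S (x + 1 + 1) (2 * m + 1)) =
      line (step t S) (x + 1) (2 * m + 1) := by
  have e1 : step t S (x + 1) = chi (S x) (S (x + 1)) (S (x + 1 + 1)) := by
    rw [step_apply hn, if_pos hx, add_sub_cancel_right]
  have e2 : step t S (x + 1 + 1) = S (x + 1 + 1) := by
    rw [step_apply hn, if_neg]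
    rw [map_add, hx, map_one]
    simp
  induction m generalizing x with
  | zero => simp [line, pull, e1]
  | succ m ih =>
    have h : 2 * (m + 1) + 1 = 2 * m + 1 + 1 + 1 := by ring
    have hx' : parity hn (x + 1 + 1 + 1) = t := by
      rw [map_add, map_add, hx, map_one, add_assoc, CharTwo.add_self_eq_zero, add_zero]
    have e3 := ih (x + 1 + 1) hx'
      (by rw [step_apply hn, if_pos hx', add_sub_cancel_right])
      (by rw [step_apply hn, if_neg (by rw [map_add, hx', map_one]; simp)])
    rw [h, show line S (x + 1 + 1) (2 * m + 1 + 1 + 1) = S (x + 1 + 1) :: S (x + 1 + 1 + 1) ::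
        line S (x + 1 + 1 + 1 + 1) (2 * m + 1) from rfl, pull, e3, ← e1, ← e2]
    rfl

/-- The involution expresses the section at time t + 1 through the wider one at time t + 2, where
`val_pull` applies. -/
theorem val_evolve_succ {n : ℕ} [NeZero n] (hn : Even n) (r : Bool) (t : ℕ) (S : Config n) :
    val r false (line (evolve (t + 2) S) (-(t + 2 : ℕ)) (2 * (t + 2) + 1))
        (0, t + 2 + r.toNat, 0, 0) =
      val r false (line (evolve (t + 1) S) (-(t + 1 : ℕ)) (2 * (t + 1) + 1))
        (0, t + 1 + r.toNat, 0, 0) := by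
  have e : evolve (t + 1) S = step (t + 1) (evolve (t + 2) S) := by
    rw [evolve_succ (t + 1), step_step hn]
  rw [e]
  generalize evolve (t + 2) S = C
  have hx : (-((t + 1 : ℕ) : ZMod n)) = -((t + 2 : ℕ) : ZMod n) + 1 := by push_cast; ring
  have h := pull_line hn (t + 1) C (-(t + 2 : ℕ)) (t + 1) (by
    rw [← hx, map_neg, CharTwo.neg_eq, map_natCast])
  rw [hx, ← h]
  have e1 : 2 * (t + 1) + 1 = 2 * t + 1 + 1 + 1 := by ring
  have e2 : 2 * (t + 2) + 1 = 2 * t + 1 + 1 + 1 + 1 + 1 := by ring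
  have e3 : t + 2 + r.toNat = t + r.toNat + 2 := by ring
  have e4 : t + 1 + r.toNat = t + r.toNat + 1 := by ring
  rw [e1, e2, e3, e4, line, line, line, line]
  exact val_pull r t _ _ _ _ _ (length_line _ _ _)

theorem val_evolve {n : ℕ} [NeZero n] (hn : Even n) (r : Bool) {t : ℕ} (ht : 1 ≤ t)
    (S : Config n) :
    val r false (line (evolve t S) (-(t : ℕ)) (2 * t + 1)) (0, t + r.toNat, 0, 0) =
      val r false [S (-1), chi (S (-1)) (S 0) (S 1), S 1] (0, 1 + r.toNat, 0, 0) := by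
  obtain ⟨t, rfl⟩ := Nat.exists_eq_add_of_le' ht
  induction t with
  | zero =>
    have e1 : evolve 1 S (-1) = S (-1) := by
      rw [evolve_succ, step_apply hn, if_neg (by simp)]; rfl
    have e2 : evolve 1 S 0 = chi (S (-1)) (S 0) (S 1) := by
      rw [evolve_succ, step_apply hn, if_pos (by simp), zero_sub, zero_add]; rfl
    have e3 : evolve 1 S 1 = S 1 := by
      rw [evolve_succ, step_apply hn, if_neg (by simp)]; rfl
    simp [line, e1, e2, e3]
  | succ t ih => exact (val_evolve_succ hn r t S).trans (ih (by omega))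

theorem cL_evolve {n : ℕ} [NeZero n] (hn : Even n) {t : ℕ} (ht : 1 ≤ t) (S : Config n) :
    cL ⊤ t (restrict t (evolve t S)) = if LeftMoverAtOrigin S then 1 else 0 := by
  have h := val_evolve hn false ht S
  rw [Bool.toNat_false, add_zero, add_zero] at h
  rw [cL_eq_val (by simp [Fits]), ofFn_restrict, h]
  unfold LeftMoverAtOrigin
  rcases zmod_two (S (-1)) with h1 | h1 <;> rcases zmod_two (S 0) with h2 | h2 <;>
    rcases zmod_two (S 1) with h3 | h3 <;> simp [h1, h2, h3, chi_eqs, val, next, nextX, nextY, scatter]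

theorem cR_evolve {n : ℕ} [NeZero n] (hn : Even n) {t : ℕ} (ht : 1 ≤ t) (S : Config n) :
    cR ⊤ t (restrict t (evolve t S)) = if RightMoverAtOrigin S then 1 else 0 := by
  have h := val_evolve hn true ht (mirror S)
  rw [evolve_mirror hn, Bool.toNat_true] at h
  rw [cR_eq_val (by simp [Fits]), ofFn_restrict_rev, h]
  simp only [mirror, neg_neg, neg_zero, RightMoverAtOrigin]
  rcases zmod_two (S (-1)) with h1 | h1 <;> rcases zmod_two (S 0) with h2 | h2 <;>
    rcases zmod_two (S 1) with h3 | h3 <;> simp [h1, h2, h3, chi_eqs, val, next, nextX, nextY, scatter]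

theorem indicator_add (n : ℕ) (S : Config n) :
    ((if LeftMoverAtOrigin S then 1 else 0) + (if RightMoverAtOrigin S then 1 else 0) : ℝ) =
      if S 0 = 1 then 1 else 0 := by
  unfold LeftMoverAtOrigin RightMoverAtOrigin
  rcases zmod_two (S (-1)) with h1 | h1 <;> rcases zmod_two (S 0) with h2 | h2 <;>
    rcases zmod_two (S 1) with h3 | h3 <;> simp [h1, h2, h3]

/-! ### The density in the Heisenberg picture -/

/-- The initial configuration from which a configuration at time `t` evolves. -/
def devolve {n : ℕ} : ℕ → Config n → Config n
  | 0, S => S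
  | t + 1, S => devolve t (step t S)

theorem evolve_devolve {n : ℕ} [NeZero n] (hn : Even n) (t : ℕ) (S : Config n) :
    evolve t (devolve t S) = S := by
  induction t generalizing S with
  | zero => rfl
  | succ t ih => rw [evolve_succ, devolve, ih, step_step hn]

theorem mapOperator_conj_diagonal {n : ℕ} [NeZero n] [DecidableEq (Config n)] {f : Config n → Config n}
    (hf : ∀ S, f (f S) = S) (d : Config n → ℝ) :
    mapOperator f * Matrix.diagonal d * mapOperator f = Matrix.diagonal fun S => d (f S) := by
  ext S S'
  rw [Matrix.mul_apply]
  simp only [Matrix.mul_diagonal, mapOperator, Matrix.of_apply, Matrix.diagonal_apply]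
  rw [Finset.sum_eq_single (f S')]
  · by_cases h : S = S'
    · subst h; simp [hf]
    · simp [hf, h]
  · intro T _ hT; simp [hT]
  · simp

/-- Each propagator is the permutation matrix of an involution, so conjugation only relabels the
diagonal. -/
theorem heisenberg_diagonal {n : ℕ} [NeZero n] [DecidableEq (Config n)] (hn : Even n) (t : ℕ) (d : Config n → ℝ) :
    heisenberg (Matrix.diagonal d) t = Matrix.diagonal fun S => d (devolve t S) := by
  induction t with
  | zero => rfl
  | succ t ih =>
    have h := mapOperator_conj_diagonal (step_step hn t) fun S => d (devolve t S)
    rw [heisenberg, ih]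
    split_ifs with ht
    · have e : (step t : Config n → Config n) = stepEven := by funext S; simp [step, ht]
      rw [e] at h
      rw [Ue, h]
      simp only [devolve, e]
    · have e : (step t : Config n → Config n) = stepOdd := by funext S; simp [step, ht]
      rw [e] at h
      rw [Uo, h]
      simp only [devolve, e]

theorem rho_eq_sum {n t : ℕ} [NeZero n] (hn : Even n) (ht : 1 ≤ t) :
    rho n t = ∑ s : Section t, (cL ⊤ t s + cR ⊤ t s) • sectionProj n t s := by
  classical
  unfold rho siteProj sectionProj
  refine (@heisenberg_diagonal n _ (fun _ _ => Classical.propDecidable _) hn t _).trans ?_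
  ext S S'
  rw [Matrix.sum_apply]
  simp only [Matrix.smul_apply, Matrix.diagonal_apply, smul_eq_mul]
  by_cases h : S = S'
  · subst h
    simp only [if_true, mul_ite, mul_one, mul_zero, Finset.sum_ite_eq, Finset.mem_univ]
    have hL := cL_evolve hn ht (devolve t S)
    have hR := cR_evolve hn ht (devolve t S)
    rw [evolve_devolve hn] at hL hR
    rw [hL, hR, indicator_add]
  · simp [h]

/-! ### Truncation and dimension -/

theorem cL_truncated {T t : ℕ} (h : t ≤ T) (s : Section t) :
    cL ((T + 1 : ℕ) : ℕ∞) t s = cL ⊤ t s := by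
  rw [cL_eq_val, cL_eq_val]
  · simp [Fits]
  · exact Nat.cast_le.2 (by omega)

theorem cR_truncated {T t : ℕ} (h : t ≤ T) (s : Section t) :
    cR ((T + 1 : ℕ) : ℕ∞) t s = cR ⊤ t s := by
  rw [cR_eq_val, cR_eq_val]
  · simp [Fits]
  · exact Nat.cast_le.2 (by omega)

/-- The values of `c` and `w` that a finite bound leaves. -/
def levelEquiv (M : ℕ) : Level (M : ℕ∞) ≃ Fin (M + 1) where
  toFun k := ⟨k.1, Nat.lt_succ_of_le (by exact_mod_cast k.2)⟩
  invFun k := ⟨k.1, by exact_mod_cast Nat.le_of_lt_succ k.2⟩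
  left_inv _ := rfl
  right_inv _ := rfl

instance (M : ℕ) : Finite (Level (M : ℕ∞)) := Finite.of_equiv _ (levelEquiv M).symm

theorem finrank_aux (M : ℕ) : Module.finrank ℝ (Aux (M : ℕ∞)) = 6 * (M + 1) ^ 2 := by
  have := Fintype.ofFinite (Level (M : ℕ∞))
  have h : Fintype.card (Level (M : ℕ∞)) = M + 1 := by
    rw [Fintype.card_congr (levelEquiv M), Fintype.card_fin]
  rw [Module.finrank_finsupp_self]
  simp only [Fintype.card_prod, Fintype.card_fin, h]
  ring

theorem finrank_aux_isBigO :
    (fun T : ℕ => (Module.finrank ℝ (Aux ((T + 1 : ℕ) : ℕ∞)) : ℝ))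
      =O[Filter.atTop] (fun T : ℕ => (T : ℝ) ^ 2) := by
  -- For T ≥ 1 one has T + 2 ≤ 3T, and 54 = 6 · 3².
  refine IsBigO.of_bound 54 (Filter.eventually_atTop.2 ⟨1, fun T hT => ?_⟩)
  have hT' : (1 : ℝ) ≤ T := by exact_mod_cast hT
  rw [finrank_aux, Real.norm_of_nonneg (by positivity), Real.norm_of_nonneg (by positivity)]
  push_cast
  nlinarith

end

end Rule54

theorem mainTheorem6 :
    -- the matrix product form of the time-evolved density
    (∀ (n t : ℕ) [NeZero n], Even n → 1 ≤ t → t < n / 2 →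
      Rule54.rho n t =
        ∑ s : Rule54.Section t, (Rule54.cL ⊤ t s + Rule54.cR ⊤ t s) • Rule54.sectionProj n t s) ∧
    -- the two terms are the indicators of a left- and of a right-mover at the origin
    (∀ (n t : ℕ) [NeZero n], Even n → 1 ≤ t → t < n / 2 → ∀ S : Rule54.Config n,
      Rule54.cL ⊤ t (Rule54.restrict t (Rule54.evolve t S)) =
          (if Rule54.LeftMoverAtOrigin S then 1 else 0) ∧
        Rule54.cR ⊤ t (Rule54.restrict t (Rule54.evolve t S)) =
          (if Rule54.RightMoverAtOrigin S then 1 else 0)) ∧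
    -- truncation of the auxiliary space, for evolution up to time `T`
    (∀ T t : ℕ, t ≤ T → ∀ s : Rule54.Section t,
      Rule54.cL ((T + 1 : ℕ) : ℕ∞) t s = Rule54.cL ⊤ t s ∧
        Rule54.cR ((T + 1 : ℕ) : ℕ∞) t s = Rule54.cR ⊤ t s) ∧
    -- the dimension of the truncated auxiliary space
    (∀ T : ℕ, Module.Finite ℝ (Rule54.Aux ((T + 1 : ℕ) : ℕ∞)) ∧
      Module.finrank ℝ (Rule54.Aux ((T + 1 : ℕ) : ℕ∞)) = 6 * (T + 2) ^ 2) ∧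
    (fun T : ℕ => (Module.finrank ℝ (Rule54.Aux ((T + 1 : ℕ) : ℕ∞)) : ℝ))
      =O[Filter.atTop] (fun T : ℕ => (T : ℝ) ^ 2) :=
  ⟨fun _ _ _ hn ht _ => Rule54.rho_eq_sum hn ht,
    fun _ _ _ hn ht _ S => ⟨Rule54.cL_evolve hn ht S, Rule54.cR_evolve hn ht S⟩,
    fun _ _ h s => ⟨Rule54.cL_truncated h s, Rule54.cR_truncated h s⟩,
    fun T => ⟨inferInstance, Rule54.finrank_aux (T + 1)⟩,
    Rule54.finrank_aux_isBigO⟩
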